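/- Let $X=\{0,1\}^d$. Predicates $\phi:X\to\{0,1\}$ are given by Boolean circuits. For a distribution $D$ on $X$ put $\mathsf{weight}_D(\phi)=\Pr_{x\leftarrow D}[\phi(x)=1]$, and let $H_\infty(D)=-\log_2\max_x D(x)$ be the min-entropy. A dataset is $\mathbf x=(x_1,\dots,x_n)\in X^n$; $|\mathbf x_\phi|$ is the number of indices $i$ with $\phi(x_i)=1$, and $p$ *isolates* $\mathbf x$ if $p(x_i)=1$ for exactly one $i$. A *predicate $k$-anonymizer* is a randomized map $\mathsf{Anon}$ from datasets $\mathbf x\in X^n$ to finite lists $\Phi$ of predicates such that always $|\mathbf x_\phi|\ge k$ for all $\phi\in\Phi$. It is *$k_{\max}$-bounded* if for every $\mathbf x$ with pairwise distinct rows the output $\Phi$ always contains some $\phi$ with $|\mathbf x_\phi|\le k_{\max}$. The *target* of $\Phi$ is the first $\phi\in\Phi$ with $|\mathbf x_\phi|\le k_{\max}$ (if there is one). An adversary $\mathsf A$ receives $d$ and the list of all pairs $(|\mathbf x_\phi|,\phi)$, $\phi\in\Phi$ (with $d$ and the counts written in unary), and outputs a predicate; its success probability is $$\mathsf{Succ}_{\le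 w}^{\mathsf A,\mathsf{Anon}}(n)=\Pr_{\mathbf x\leftarrow D^n,\ \Phi\leftarrow\mathsf{Anon}(\mathbf x),\ p\leftarrow\mathsf A}\bigl[p\text{ isolates }\mathbf x\ \text{ and }\ \mathsf{weight}_D(p)\le w\bigr].$$ **Theorem.** For every $k_{\max}\ge2$ there is a (uniform) probabilistic polynomial-time algorithm $\mathsf A$ such that the following holds for all $n,d,m\in\mathbb N$, all $k\ge 2$, all real $\alpha>0$ and $w_{\mathrm{low}}>0$, all distributions $D$ on $\{0,1\}^d$ with $$H_\infty(D)\ \ge\ m+2\log_2(1/\alpha^2)+k_{\max}\log_2 n ,$$ and all $k_{\max}$-bounded predicate $k$-anonymizers $\mathsf{Anon}$. Let $\eta$ be the probability, over $\mathbf x\leftarrow D^n$ and $\Phi\leftarrow\mathsf{Anon}(\mathbf x)$, that $\Phi$ has a target $\phi$ and $\mathsf{weight}_D(\phi)\le w_{\mathrm{low}}$, and let $\eta^*$ be the probability that in addition the rows of $\mathbf x$ that satisfy $\phi$ are pairwise distinct. Then $$\mathsf{Succ}_{\le w_{\mathrm{low}}}^{\mathsf A,\mathsf{Anon}}(n)\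 \ge\ \eta^*\cdot\bigl(e^{-1}-2^{-m}n-k\alpha^2\bigr) \qquad\text{and}\qquad \eta^*\ \ge\ \eta-2^{-m}\alpha^4 .$$ (When $n=0$, the term $k_{\max}\log_2 n$ is read as $0$.) -/

import Mathlib

/-! ### Predicates on `{0,1}^d`, given by Boolean circuits -/

/-- A gate of a Boolean circuit. `inp i` reads the `i`-th input bit. The other gates read earlier
wires, which are numbered backwards: wire `0` is the output of the gate computed just before,
wire `1` of the one before that, and so on. -/
inductive Gate where
  | inp (i : ℕ)
  | const (b : Bool)
  | neg (j : ℕ)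
  | conj (j k : ℕ)
  | disj (j k : ℕ)
  | xor (j k : ℕ)

/-- The value of a gate on the input `x`, when `ws` lists the values of the earlier wires, most
recent first. References to input bits or wires that do not exist read `false`. -/
def Gate.eval {d : ℕ} (x : Fin d → Bool) (ws : List Bool) : Gate → Bool
  | .inp i => if h : i < d then x ⟨i, h⟩ else false
  | .const b => b
  | .neg j => !(ws.getD j false)
  | .conj j k => ws.getD j false && ws.getD k false
  | .disj j k => ws.getD j false || ws.getD k false
  | .xor j k => Bool.xor (ws.getD j false) (ws.getD k false)

/-- A circuit: a list of gates in the order in which they are computed; the last gate is the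
output. -/
abbrev Circuit := List Gate

/-- The predicate on `{0,1}^d` that a circuit describes. -/
def Circuit.eval {d : ℕ} (C : Circuit) (x : Fin d → Bool) : Bool :=
  (C.foldl (fun ws g => g.eval x ws :: ws) []).headD false

/-! ### Writing circuits on tapes -/

/-- The alphabet in which circuits are written. -/
inductive TapeSym where
  | one | sep | fin | inp | tru | fls | neg | conj | disj | xor
  deriving DecidableEq

instance : Fintype TapeSym :=
  ⟨{.one, .sep, .fin, .inp, .tru, .fls, .neg, .conj, .disj, .xor}, by rintro (_ | _) <;> decide⟩

/-- Natural numbers are written in unary, ended by a separator. -/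
def encNat (j : ℕ) : List TapeSym := List.replicate j TapeSym.one ++ [TapeSym.sep]

def encGate : Gate → List TapeSym
  | .inp i => TapeSym.inp :: encNat i
  | .const true => [TapeSym.tru]
  | .const false => [TapeSym.fls]
  | .neg j => TapeSym.neg :: encNat j
  | .conj j k => TapeSym.conj :: (encNat j ++ encNat k)
  | .disj j k => TapeSym.disj :: (encNat j ++ encNat k)
  | .xor j k => TapeSym.xor :: (encNat j ++ encNat k)

def encCircuit (C : Circuit) : List TapeSym := C.flatMap encGate ++ [TapeSym.fin]

/-- What an adversary gets to see: the record length `d`, and the released collection of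
predicates, each one given by a circuit and preceded by the number of rows that satisfy it. -/
abbrev Release := ℕ × List (ℕ × Circuit)

def encRelease (R : Release) : List TapeSym :=
  encNat R.1 ++ R.2.flatMap (fun e => encNat e.1 ++ encCircuit e.2) ++ [TapeSym.fin]

theorem encNat_append_inj {a b : ℕ} {s t : List TapeSym} (h : encNat a ++ s = encNat b ++ t) :
    a = b ∧ s = t := by
  induction a generalizing b with
  | zero => cases b <;> simp_all [encNat, List.replicate_succ]
  | succ a ih =>
    cases b with
    | zero => simp [encNat, List.replicate_succ] at h
    | succ b =>
      have := @ih b (by simpa [encNat, List.replicate_succ] using h)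
      simp [this]

theorem encGate_append_inj {g g' : Gate} {s t : List TapeSym} (h : encGate g ++ s = encGate g' ++ t) :
    g = g' ∧ s = t := by
  rcases g with i | (_ | _) | i | ⟨i, j⟩ | ⟨i, j⟩ | ⟨i, j⟩ <;>
  rcases g' with i' | (_ | _) | i' | ⟨i', j'⟩ | ⟨i', j'⟩ | ⟨i', j'⟩ <;>
  simp [encGate] at h ⊢ <;>
  first
  | exact h
  | exact encNat_append_inj h
  | (obtain ⟨h1, h2⟩ := encNat_append_inj h
     obtain ⟨h3, h4⟩ := encNat_append_inj h2
     exact ⟨⟨h1, h3⟩, h4⟩)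

theorem encCircuit_append_inj {C C' : Circuit} {s t : List TapeSym}
    (h : encCircuit C ++ s = encCircuit C' ++ t) : C = C' ∧ s = t := by
  have ne : ∀ (g : Gate) (u v : List TapeSym), encGate g ++ u ≠ TapeSym.fin :: v := by
    rintro (i | (_ | _) | i | ⟨i, j⟩ | ⟨i, j⟩ | ⟨i, j⟩) u v <;> simp [encGate]
  induction C generalizing C' with
  | nil =>
    cases C' with
    | nil => simpa [encCircuit] using h
    | cons g C' =>
      exact absurd (by simpa [encCircuit] using h.symm) (ne g (encCircuit C' ++ t) s)
  | cons g C ih =>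
    cases C' with
    | nil => exact absurd (by simpa [encCircuit] using h) (ne g (encCircuit C ++ s) t)
    | cons g' C' =>
      have h' : encGate g ++ (encCircuit C ++ s) = encGate g' ++ (encCircuit C' ++ t) := by
        simpa [encCircuit] using h
      obtain ⟨h1, h2⟩ := encGate_append_inj h'
      obtain ⟨h3, h4⟩ := ih h2
      exact ⟨by rw [h1, h3], h4⟩

theorem encCircuit_injective : Function.Injective encCircuit := fun C C' h =>
  (encCircuit_append_inj (s := []) (t := []) (by simpa using h)).1

theorem encRelease_injective : Function.Injective encRelease := by
  rintro ⟨d, L⟩ ⟨d', L'⟩ h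
  have ne : ∀ (a : ℕ) (u v : List TapeSym), encNat a ++ u ≠ TapeSym.fin :: v := by
    rintro (_ | a) u v <;> simp [encNat, List.replicate_succ]
  simp only [encRelease, List.append_assoc] at h
  obtain ⟨h1, h2⟩ := encNat_append_inj h
  refine Prod.ext h1 ?_
  clear h h1
  simp only at h2 ⊢
  induction L generalizing L' with
  | nil =>
    cases L' with
    | nil => rfl
    | cons e L' =>
      refine absurd ?_ (ne e.1 (encCircuit e.2 ++
        (L'.flatMap (fun e => encNat e.1 ++ encCircuit e.2) ++ [TapeSym.fin])) [])
      simpa using h2.symm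
  | cons e L ih =>
    cases L' with
    | nil =>
      refine absurd ?_ (ne e.1 (encCircuit e.2 ++
        (L.flatMap (fun e => encNat e.1 ++ encCircuit e.2) ++ [TapeSym.fin])) [])
      simpa using h2
    | cons e' L' =>
      simp only [List.flatMap_cons, List.append_assoc] at h2
      obtain ⟨h3, h4⟩ := encNat_append_inj h2
      obtain ⟨h5, h6⟩ := encCircuit_append_inj h4
      rw [ih L' h6, Prod.ext h3 h5]

/-! ### Efficient, uniform, randomized algorithms -/

/-- `A` is computed by one probabilistic polynomial-time Turing machine: there are a deterministic
machine, running in time polynomial in the length of its whole input, and a polynomial `ℓ`, such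
that `A a` is the output of the machine on `a` and `ℓ(|a|)` independent fair coin flips, where
`|a|` is the length of the encoding of `a`. -/
def IsProbPolyTime {α β Γ Δ : Type} (ea : α → List Γ) (eb : β → List Δ) (A : α → PMF β) : Prop :=
  ∃ (ℓ : Polynomial ℕ) (f : α × List Bool → β),
    Nonempty (Turing.TM2ComputableInPolyTime
      (fun p : α × List Bool => (ea p.1).map Sum.inl ++ p.2.map Sum.inr) eb f) ∧
    ∀ a, A a = (PMF.uniformOfFintype (Fin (ℓ.eval (ea a).length) → Bool)).map
      (fun r => f (a, List.ofFn r))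

/-! ### Datasets, weights, isolation -/

/-- A dataset of `n` rows from `{0,1}^d`. -/
abbrev Dataset (n d : ℕ) := Fin n → Fin d → Bool

noncomputable section

/-- The probability of an event under a discrete distribution. -/
def prob {Ω : Type*} (P : PMF Ω) (E : Ω → Prop) : ℝ := (P.toOuterMeasure {ω | E ω}).toReal

/-- Min-entropy, in bits. -/
def minEntropy {X : Type*} (D : PMF X) : ℝ := -Real.logb 2 (⨆ x, (D x).toReal)

/-- The distribution `D^n` of `n` independent samples from `D`. -/
def iid {X : Type*} [Fintype X] (D : PMF X) (n : ℕ) : PMF (Fin n → X) :=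
  PMF.ofFintype (fun x => ∏ i, D (x i)) (by
    classical
    rw [← Fintype.piFinset_univ, ← Finset.prod_univ_sum]
    have h : ∑ x, D x = 1 := by rw [← tsum_fintype (L := .unconditional _)]; exact D.tsum_coe
    simp [h])

/-- `weight_D(φ)`: the probability that a sample from `D` satisfies `φ`. -/
def weight {d : ℕ} (D : PMF (Fin d → Bool)) (φ : Circuit) : ℝ := prob D fun x => φ.eval x = true

/-- `|x_φ|`: the number of rows of `x` that satisfy `φ`. -/
def rowCount {n d : ℕ} (x : Dataset n d) (φ : Circuit) : ℕ :=
  (Finset.univ.filter fun i => φ.eval (x i) = true).card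

/-- `p` isolates a row of `x`: exactly one row satisfies `p`. -/
def Isolates {n d : ℕ} (p : Circuit) (x : Dataset n d) : Prop := ∃! i, p.eval (x i) = true

/-! ### Predicate anonymizers -/

/-- A randomized mechanism that maps a dataset to a finite collection of predicates. -/
abbrev Anonymizer (n d : ℕ) := Dataset n d → PMF (List Circuit)

def IsPredicateKAnonymous {n d : ℕ} (k : ℕ) (Anon : Anonymizer n d) : Prop :=
  ∀ x, ∀ Φ ∈ (Anon x).support, ∀ φ ∈ Φ, k ≤ rowCount x φ

/-- Boundedness, on datasets without repeated rows. (On `n > kmax` copies of one row no predicate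
is satisfied by at least one and at most `kmax` rows.) -/
def IsKMaxBounded {n d : ℕ} (kmax : ℕ) (Anon : Anonymizer n d) : Prop :=
  ∀ x, Function.Injective x → ∀ Φ ∈ (Anon x).support, ∃ φ ∈ Φ, rowCount x φ ≤ kmax

/-- The first predicate of the release `Φ` that at most `kmax` rows satisfy. -/
def target {n d : ℕ} (kmax : ℕ) (x : Dataset n d) (Φ : List Circuit) : Option Circuit :=
  Φ.find? fun φ => decide (rowCount x φ ≤ kmax)

/-- The joint distribution of a dataset of `n` samples from `D` and its release. -/
def releaseExp {n d : ℕ} (D : PMF (Fin d → Bool)) (Anon : Anonymizer n d) :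
    PMF (Dataset n d × List Circuit) :=
  (iid D n).bind fun x => (Anon x).map fun Φ => (x, Φ)

/-- The joint distribution of a dataset `x` of `n` samples from `D` and of the predicate that the
adversary `A` outputs on the release of `x`. -/
def attackExp {n d : ℕ} (A : Release → PMF Circuit) (D : PMF (Fin d → Bool))
    (Anon : Anonymizer n d) : PMF (Dataset n d × Circuit) :=
  (releaseExp D Anon).bind fun e =>
    (A (d, e.2.map fun φ => (rowCount e.1 φ, φ))).map fun p => (e.1, p)

/-- The probability that `A` predicate singles out with a predicate of weight at most `w`. -/
def succLow {n d : ℕ} (A : Release → PMF Circuit) (D : PMF (Fin d → Bool))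
    (Anon : Anonymizer n d) (w : ℝ) : ℝ :=
  prob (attackExp A D Anon) fun e => Isolates e.2 e.1 ∧ weight D e.2 ≤ w

/-- The probability that the released target predicate has weight at most `w`. -/
def eta {n d : ℕ} (kmax : ℕ) (D : PMF (Fin d → Bool)) (Anon : Anonymizer n d) (w : ℝ) : ℝ :=
  prob (releaseExp D Anon) fun e => ∃ φ, target kmax e.1 e.2 = some φ ∧ weight D φ ≤ w

/-- The probability that the released target predicate has weight at most `w` and that the rows
that satisfy it are pairwise distinct. -/
def etaDistinct {n d : ℕ} (kmax : ℕ) (D : PMF (Fin d → Bool)) (Anon : Anonymizer n d) (w : ℝ) :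
    ℝ :=
  prob (releaseExp D Anon) fun e => ∃ φ, target kmax e.1 e.2 = some φ ∧ weight D φ ≤ w ∧
    Set.InjOn e.1 {i | φ.eval (e.1 i) = true}

end

/-! The adversary takes the first released predicate `φ` with count `k' ≤ kmax`, which is exactly
the target, and outputs `φ(x) ∧ T(Cx) ∈ Q`. Here `C` is a random Boolean matrix with `N` rows, `T`
is a random table from `N`-bit strings to `N`-bit strings, and `Q` is a fixed set of `⌊2^N / k'⌋`
strings. The output implies `φ`, so its weight is at most that of `φ`.

Suppose that the `k'` rows satisfying `φ` are distinct. By a union bound `C` separates them except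
with probability `k'² / 2^N` (`le_prob_injOn_linearHash`). Their table entries are then independent,
and with `q = ⌊2^N / k'⌋ / 2^N` exactly one is accepted with probability at least `k' q (1 -
q)^(k'-1)` (`prob_existsUnique_random_function`). As `N → ∞` the product of the two bounds tends to
`(1 - 1/k')^(k'-1)`, which is strictly above `1/e`. Only finitely many `k'` occur, so one constant
`N` depending on `kmax` alone gives at least `1/e` (`exists_precision`, `exists_isolating_tables`).
This holds for every fixed release, whatever the dependence between `φ` and the data, because the
randomness is the adversary's own; the subtracted error terms are slack.

The min-entropy controls `η - η*`: this is at most the probability that `D^n` repeats a row, hence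
at most `n² max D` (`eta_le`, `prob_not_injective_le`, `sq_mul_iSup_le`).

For efficiency, `N`, the table and all strings derived from it have constant size. The machine only
copies a circuit and writes one block of gates per coordinate (`computable_attackCircuit`). -/

/-! ### Evaluating circuits on top of existing wires -/

namespace Circuit

/-- The wires after the gates `C` have been computed on top of the wires `ws`. -/
def wires {d : ℕ} (x : Fin d → Bool) (C : List Gate) (ws : List Bool) : List Bool :=
  C.foldl (fun ws g => g.eval x ws :: ws) ws

variable {d : ℕ} (x : Fin d → Bool)

@[simp] theorem wires_nil (ws : List Bool) : wires x [] ws = ws := rfl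

@[simp] theorem wires_cons (g : Gate) (C : List Gate) (ws : List Bool) :
    wires x (g :: C) ws = wires x C (g.eval x ws :: ws) := rfl

@[simp] theorem wires_append (C C' : List Gate) (ws : List Bool) :
    wires x (C ++ C') ws = wires x C' (wires x C ws) := by
  simp [wires]

theorem eval_eq_headD_wires (C : Circuit) : C.eval x = (wires x C []).headD false := rfl

theorem wires_eq_append (C : List Gate) (ws : List Bool) :
    ∃ us : List Bool, us.length = C.length ∧ wires x C ws = us ++ ws := by
  induction C generalizing ws with
  | nil => exact ⟨[], rfl, rfl⟩
  | cons g C ih =>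
    obtain ⟨us, h, h'⟩ := ih (g.eval x ws :: ws)
    exact ⟨us ++ [g.eval x ws], by simp [h], by simp [h']⟩

end Circuit

open Circuit

/-- Every Boolean function of `N` consecutive wires is computed by a circuit. -/
theorem exists_gates_eval (N : ℕ) (F : (Fin N → Bool) → Bool) (off : ℕ) :
    ∃ G : List Gate, ∀ (d : ℕ) (x : Fin d → Bool) (ws : List Bool),
      (wires x G ws).getD 0 false = F fun i => ws.getD (off + i) false := by
  induction N generalizing off with
  | zero => exact ⟨[.const (F Fin.elim0)], fun d x ws => by
      simp [Gate.eval]; congr 1; exact Subsingleton.elim _ _⟩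
  | succ N ih =>
    obtain ⟨G₀, h₀⟩ := ih (fun b => F (Fin.cons false b)) (off + 1)
    obtain ⟨G₁, h₁⟩ := ih (fun b => F (Fin.cons true b)) (G₀.length + (off + 1))
    -- A multiplexer: with selector `b` and branch values `f₀`, `f₁`, the three last gates compute
    -- `f₀ ⊕ (b ∧ (f₀ ⊕ f₁))`. Each gate shifts the numbering of older wires by one, whence the
    -- offsets `1` and `2`.
    refine ⟨G₀ ++ G₁ ++ [.xor 0 G₁.length, .conj 0 (1 + G₁.length + G₀.length + off),
      .xor 0 (2 + G₁.length)], fun d x ws => ?_⟩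
    obtain ⟨u₀, l₀, e₀⟩ := wires_eq_append x G₀ ws
    obtain ⟨u₁, l₁, e₁⟩ := wires_eq_append x G₁ (u₀ ++ ws)
    specialize h₀ d x ws
    specialize h₁ d x (u₀ ++ ws)
    rw [e₀] at h₀
    rw [e₁] at h₁
    have r (i : ℕ) : (u₀ ++ ws).getD (G₀.length + i) false = ws.getD i false := by
      rw [List.getD_append_right _ _ _ _ (by omega)]; congr 1; omega
    have r' (i : ℕ) (vs : List Bool) : (u₁ ++ vs).getD (G₁.length + i) false = vs.getD i false := by
      rw [List.getD_append_right _ _ _ _ (by omega)]; congr 1; omega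
    simp only [add_assoc, r] at h₁
    have hF : F (fun i => ws.getD (off + i) false) = F (Fin.cons (ws.getD off false)
        fun i : Fin N => ws.getD (off + (1 + i)) false) := by
      congr 1
      funext i
      refine Fin.cases ?_ (fun i => ?_) i <;> simp [add_comm]
    have e : wires x (G₀ ++ G₁) ws = u₁ ++ (u₀ ++ ws) := by simp [e₀, e₁]
    have rr := r' 0 (u₀ ++ ws)
    rw [add_zero] at rr
    have r2 := r' (G₀.length + off) (u₀ ++ ws)
    rw [r] at r2
    rw [wires_append, e, hF]
    set W := u₁ ++ (u₀ ++ ws)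
    have a1 (v : Bool) (i : ℕ) : (v :: W).getD (1 + i) false = W.getD i false := by
      rw [add_comm]; rfl
    have a2 (v v' : Bool) (i : ℕ) : (v :: v' :: W).getD (2 + i) false = W.getD i false := by
      rw [add_comm]; rfl
    simp only [wires_cons, wires_nil, Gate.eval, add_assoc, a1, a2, rr, r2, h₁, h₀,
      List.getD_cons_zero]
    cases ws.getD off false <;> simp

/-- Gates that update the last `bs.length` of `n` wires: `b` is added to the wire at position `n`
where the coefficient `b` is set, times the wire at position `j`. -/
def columnGates (n : ℕ) : ℕ → List Bool → List Gate
  | _, [] => []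
  | j, b :: bs => (if b then .xor j n else .conj n n) :: columnGates n (j + 1) bs

/-- Every gate pushes one wire, so the fixed position `n` always shows the oldest entry of the
vector not yet processed, while `v` recedes by one place per gate. Entries are therefore processed
last to first, which explains the reversal of `bs`. -/
theorem wires_columnGates {d : ℕ} (x : Fin d → Bool) (n : ℕ) (v : Bool) (bs : List Bool)
    (new pend ws : List Bool) (hp : pend.length = bs.length) (hn : new.length + pend.length = n) :
    wires x (columnGates n new.length bs) (new ++ v :: (pend ++ ws)) =
      List.zipWith (fun a c => Bool.xor a (c && v)) pend bs.reverse ++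
        (new ++ v :: (pend ++ ws)) := by
  induction bs generalizing new pend ws with
  | nil =>
    rw [List.length_nil, List.length_eq_zero_iff] at hp
    simp [hp, columnGates]
  | cons b bs ih =>
    obtain ⟨p, a, rfl⟩ : ∃ p a, pend = p ++ [a] :=
      ⟨pend.dropLast, pend.getLast (by rintro rfl; simp at hp), (List.dropLast_append_getLast _).symm⟩
    replace hp : p.length = bs.length := by simpa using hp
    replace hn : new.length + (p.length + 1) = n := by simpa using hn
    have e1 : (new ++ v :: (p ++ [a] ++ ws)).getD n false = a := by
      have : new ++ v :: (p ++ [a] ++ ws) = (new ++ v :: p) ++ (a :: ws) := by simp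
      rw [this, List.getD_append_right _ _ _ _ (by simp; omega)]
      have : n - (new ++ v :: p).length = 0 := by simp; omega
      rw [this]; rfl
    have e2 : (new ++ v :: (p ++ [a] ++ ws)).getD new.length false = v := by
      rw [List.getD_append_right _ _ _ _ le_rfl, Nat.sub_self]; rfl
    have e3 : Gate.eval x (new ++ v :: (p ++ [a] ++ ws))
        (if b then .xor new.length n else .conj n n) = Bool.xor a (b && v) := by
      cases b
      · simp only [Bool.false_eq_true, if_false, Gate.eval, e1]; simp
      · simp only [if_true, Gate.eval, e1, e2, Bool.true_and]
        exact Bool.xor_comm _ _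
    rw [columnGates, wires_cons, e3]
    have := ih (Bool.xor a (b && v) :: new) p (a :: ws) hp (by simp; omega)
    simp only [List.length_cons, List.cons_append] at this
    rw [show new ++ v :: (p ++ [a] ++ ws) = new ++ v :: (p ++ a :: ws) by simp, this,
      List.reverse_cons, List.zipWith_append (by simp [hp])]
    simp

/-- The gates that add `v • c` to a vector of `s` wires, where `v` is the latest wire. The wire
after the vector is preserved. -/
def blockGates {s : ℕ} (c : Fin s → Bool) : List Gate :=
  .conj (s + 1) (s + 1) :: columnGates (s + 1) 1 (List.ofFn c).reverse

/-- The first gate copies `b` to the top, so that the updated vector lands directly above a copy of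
`b`. The layout "vector, then `b`" is thus restored and the block can be iterated. -/
theorem wires_blockGates {d s : ℕ} (x : Fin d → Bool) (c a : Fin s → Bool) (v b : Bool)
    (ws : List Bool) :
    ∃ us, wires x (blockGates c) (v :: (List.ofFn a ++ b :: ws)) =
      List.ofFn (fun j => Bool.xor (a j) (c j && v)) ++ b :: us := by
  have e : Gate.eval x (v :: (List.ofFn a ++ b :: ws)) (.conj (s + 1) (s + 1)) = b := by
    have : (v :: (List.ofFn a ++ b :: ws)).getD (s + 1) false = b := by
      rw [List.getD_cons_succ, List.getD_append_right _ _ _ _ (by simp)]; simp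
    simp only [Gate.eval, this, Bool.and_self]
  have := wires_columnGates x (s + 1) v (List.ofFn c).reverse [b] (List.ofFn a) (b :: ws) (by simp)
    (by simp [add_comm])
  refine ⟨v :: (List.ofFn a ++ b :: ws), ?_⟩
  rw [blockGates, wires_cons, e]
  refine this.trans ?_
  rw [List.reverse_reverse, List.singleton_append]
  congr 1
  apply List.ext_getElem <;> simp

/-- The circuit that hashes the input by the matrix whose columns are read off the bits `r`, last
column first. -/
def hashGates (s : ℕ) : ℕ → List Bool → List Gate
  | 0, _ => []
  | i + 1, r => .inp i :: (blockGates (fun j : Fin s => r.getD j false) ++ hashGates s i (r.drop s))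

/-- The vector on the wires after the gates `hashGates s i r`. -/
def hashValue {d : ℕ} (x : Fin d → Bool) (s : ℕ) :
    ℕ → List Bool → (Fin s → Bool) → Fin s → Bool
  | 0, _, a => a
  | i + 1, r, a => hashValue x s i (r.drop s) fun j =>
      Bool.xor (a j) (r.getD j false && if h : i < d then x ⟨i, h⟩ else false)

theorem wires_hashGates {d s : ℕ} (x : Fin d → Bool) (i : ℕ) (r : List Bool) (a : Fin s → Bool)
    (b : Bool) (ws : List Bool) :
    ∃ us, wires x (hashGates s i r) (List.ofFn a ++ b :: ws) =
      List.ofFn (hashValue x s i r a) ++ b :: us := by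
  induction i generalizing r a ws with
  | zero => exact ⟨ws, rfl⟩
  | succ i ih =>
    obtain ⟨us, h⟩ := wires_blockGates x (fun j : Fin s => r.getD j false) a
      (Gate.eval x (List.ofFn a ++ b :: ws) (.inp i)) b ws
    rw [hashGates, wires_cons, wires_append, h]
    exact ih _ _ _

/-- A circuit that applies the function `F` to `s` wires and takes the conjunction with the next
wire. -/
noncomputable def finalGates {s : ℕ} (F : (Fin s → Bool) → Bool) : List Gate :=
  (exists_gates_eval (s + 1) (fun b => b (Fin.last s) && F fun i => b i.castSucc) 0).choose

/-- The restriction of `φ` to the points whose hash satisfies `F`. -/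
noncomputable def hashCircuit {s : ℕ} (φ : Circuit) (d : ℕ) (r : List Bool)
    (F : (Fin s → Bool) → Bool) : Circuit :=
  φ ++ List.replicate s (.const false) ++ hashGates s d r ++ finalGates F

theorem wires_replicate_const {d : ℕ} (x : Fin d → Bool) (s : ℕ) (ws : List Bool) :
    wires x (List.replicate s (.const false)) ws = List.replicate s false ++ ws := by
  induction s generalizing ws with
  | zero => rfl
  | succ s ih =>
    rw [List.replicate_succ, wires_cons, ih, List.replicate_succ']
    simp [Gate.eval]

theorem getD_finalGates {d s : ℕ} (x : Fin d → Bool) (F : (Fin s → Bool) → Bool)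
    (a : Fin s → Bool) (b : Bool) (ws : List Bool) :
    (wires x (finalGates F) (List.ofFn a ++ b :: ws)).getD 0 false = (b && F a) := by
  rw [finalGates, (exists_gates_eval (s + 1) (fun b => b (Fin.last s) && F fun i => b i.castSucc)
    0).choose_spec]
  congr 1
  · simp only [zero_add]
    rw [List.getD_append_right _ _ _ _ (by simp)]; simp
  · congr 1
    funext i
    simp only [zero_add]
    rw [List.getD_append _ _ _ _ (by simp), List.getD_eq_getElem _ _ (by simp)]; simp

/-- The output wire of `φ` plays the role of the wire `b` carried along below the hash; `φ ≠ []`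
guarantees that this wire exists. -/
theorem eval_hashCircuit {d s : ℕ} {φ : Circuit} (hφ : φ ≠ []) (r : List Bool) (F : (Fin s → Bool) → Bool)
    (x : Fin d → Bool) :
    (hashCircuit φ d r F).eval x = (φ.eval x && F (hashValue x s d r fun _ => false)) := by
  rw [eval_eq_headD_wires, hashCircuit, wires_append, wires_append, wires_append,
    wires_replicate_const, eval_eq_headD_wires]
  have hd (l : List Bool) : l.headD false = l.getD 0 false := by cases l <;> rfl
  have e : List.replicate s false = List.ofFn (fun _ : Fin s => false) := by simp
  rw [e, hd, hd]
  cases hw : wires x φ [] with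
  | cons b ws =>
    obtain ⟨us, h⟩ := wires_hashGates x d r (fun _ : Fin s => false) b ws
    rw [h, getD_finalGates]; rfl
  | nil =>
    obtain ⟨us, h, h'⟩ := wires_eq_append x φ []
    rw [hw] at h'
    have : φ.length = 0 := by
      rw [← h, (List.append_eq_nil_iff.1 h'.symm).1]; rfl
    exact absurd (List.length_eq_zero_iff.1 this) hφ

/-! ### Uniform probabilities -/

theorem prob_uniform {Ω : Type*} [Fintype Ω] [Nonempty Ω] (P : Ω → Prop) [DecidablePred P] :
    prob (PMF.uniformOfFintype Ω) P =
      ((Finset.univ.filter P).card : ℝ) / Fintype.card Ω := by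
  rw [prob, PMF.toOuterMeasure_uniformOfFintype_apply, ENNReal.toReal_div]
  simp [Fintype.card_subtype]

theorem prob_nonneg {Ω : Type*} (p : PMF Ω) (P : Ω → Prop) : 0 ≤ prob p P := ENNReal.toReal_nonneg

theorem toOuterMeasure_ne_top {Ω : Type*} (p : PMF Ω) (s : Set Ω) : p.toOuterMeasure s ≠ ⊤ :=
  ne_top_of_le_ne_top ENNReal.one_ne_top (by
    rw [PMF.toOuterMeasure_apply, ← p.tsum_coe]
    exact ENNReal.tsum_le_tsum fun a => Set.indicator_le_self _ _ _)

theorem prob_mono {Ω : Type*} (p : PMF Ω) {P P' : Ω → Prop} (h : ∀ ω ∈ p.support, P ω → P' ω) :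
    prob p P ≤ prob p P' :=
  ENNReal.toReal_mono (toOuterMeasure_ne_top p _) (PMF.toOuterMeasure_mono p
    (fun ω hω => h ω hω.2 hω.1))

theorem prob_exists_le_sum {Ω ι : Type*} (p : PMF Ω) (S : Finset ι) (E : ι → Ω → Prop) :
    prob p (fun ω => ∃ i ∈ S, E i ω) ≤ ∑ i ∈ S, prob p (E i) := by
  simp only [prob]
  rw [← ENNReal.toReal_sum fun i _ => toOuterMeasure_ne_top p _]
  refine ENNReal.toReal_mono ?_ ?_
  · exact ENNReal.sum_ne_top.2 fun i _ => toOuterMeasure_ne_top p _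
  · convert! MeasureTheory.measure_biUnion_finset_le (μ := p.toOuterMeasure) S
      fun i => {ω | E i ω} using 2
    ext; simp

theorem prob_map {Ω Ω' : Type*} (p : PMF Ω) (f : Ω → Ω') (P : Ω' → Prop) :
    prob (p.map f) P = prob p fun ω => P (f ω) := by
  rw [prob, PMF.toOuterMeasure_map_apply]; rfl

theorem prob_not {Ω : Type*} (p : PMF Ω) (P : Ω → Prop) :
    1 - prob p (fun ω => ¬ P ω) ≤ prob p P := by
  have h : prob p (fun _ => True) = 1 := by
    rw [prob, (PMF.toOuterMeasure_apply_eq_one_iff p {_ω | True}).2 (fun _ _ => trivial),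
      ENNReal.toReal_one]
  have := prob_exists_le_sum p {true, false} (fun b ω => if b then P ω else ¬ P ω)
  simp only [Finset.mem_insert, Finset.mem_singleton] at this
  have h' : prob p (fun _ => True) ≤
      prob p (fun ω => ∃ i, (i = true ∨ i = false) ∧ if i = true then P ω else ¬ P ω) :=
    prob_mono p fun ω _ _ => by by_cases h : P ω <;> simp [h]
  simp at this
  simp at h'
  linarith

/-- A surjective homomorphism maps the uniform distribution to the uniform distribution. -/
theorem prob_uniform_comp_surjective {G H : Type*} [AddGroup G] [Fintype G] [AddGroup H] [Fintype H]
    (f : G →+ H) (hf : Function.Surjective f) (P : H → Prop) :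
    prob (PMF.uniformOfFintype G) (fun g => P (f g)) = prob (PMF.uniformOfFintype H) P := by
  classical
  -- All fibres have the size of the kernel. Taking `Q` to be everything gives the size of `G`, and
  -- the kernel size cancels in the quotient.
  have key (Q : H → Prop) : (Finset.univ.filter fun g => Q (f g)).card =
      (Finset.univ.filter Q).card * (Finset.univ.filter fun g => f g = 0).card := by
    rw [Finset.card_eq_sum_card_fiberwise (f := f) (t := Finset.univ.filter Q)
      (fun g hg => by simpa using hg), Finset.sum_const_nat]
    intro h hh
    rw [← AddMonoidHom.card_fiber_eq_of_mem_range f (hf h) (hf 0)]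
    congr 1
    ext g
    simp only [Finset.mem_filter, Finset.mem_univ, true_and] at hh ⊢
    exact ⟨fun h => h.2, fun h => ⟨h ▸ hh, h⟩⟩
  have hG := key fun _ => True
  simp only [Finset.filter_true, Finset.card_univ] at hG
  have h0 : (Finset.univ.filter fun g => f g = 0).card ≠ 0 := by
    intro h
    rw [h, mul_zero] at hG
    exact Fintype.card_ne_zero hG
  rw [prob_uniform, prob_uniform, key P, hG]
  push_cast
  exact mul_div_mul_right _ _ (by exact_mod_cast h0)

/-- Conditioning on the second coordinate, by counting fibres: each `ω'` with `P'` contributes at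
least `q * card Ω` pairs. -/
theorem mul_le_prob_uniform_prod {Ω Ω' : Type*} [Fintype Ω] [Nonempty Ω] [Fintype Ω'] [Nonempty Ω']
    (P : Ω × Ω' → Prop) (P' : Ω' → Prop) {p q : ℝ} (hq : 0 ≤ q)
    (hP' : p ≤ prob (PMF.uniformOfFintype Ω') P')
    (hP : ∀ ω', P' ω' → q ≤ prob (PMF.uniformOfFintype Ω) fun ω => P (ω, ω')) :
    p * q ≤ prob (PMF.uniformOfFintype (Ω × Ω')) P := by
  classical
  refine (mul_le_mul_of_nonneg_right hP' hq).trans ?_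
  simp only [prob_uniform] at hP ⊢
  have h1 : (0 : ℝ) < Fintype.card Ω := by exact_mod_cast Fintype.card_pos
  have h2 : (0 : ℝ) < Fintype.card Ω' := by exact_mod_cast Fintype.card_pos
  have key : ((Finset.univ.filter P').card : ℝ) * (q * Fintype.card Ω) ≤
      (Finset.univ.filter P).card := by
    rw [Finset.card_eq_sum_card_fiberwise (f := Prod.snd) (t := Finset.univ) (fun _ _ => by simp)]
    push_cast
    rw [← nsmul_eq_mul, ← Finset.sum_const]
    refine (Finset.sum_le_sum fun ω' hω' => ?_).trans (Finset.sum_le_univ_sum_of_nonneg fun _ => by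
      positivity)
    have := (le_div_iff₀ h1).1 (hP ω' (by simpa using hω'))
    refine this.trans (Nat.cast_le.2 ?_)
    refine Finset.card_le_card_of_injOn (fun ω => (ω, ω')) (fun ω hω => ?_) (fun a _ b _ h => ?_)
    · simpa using hω
    · simpa using h
  rw [Fintype.card_prod, div_mul_eq_mul_div, div_le_div_iff₀ h2 (by positivity)]
  push_cast
  nlinarith

/-! ### Linear hashing -/

/-- Multiplication by the Boolean matrix with columns `C i`. -/
def linearHash {d s : ℕ} (C : Fin d → Fin s → Bool) (y : Fin d → Bool) : Fin s → Bool :=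
  fun j => ∑ i, C i j * y i

/-- By linearity a collision means that `C` kills `y - y'`. This vector has an entry `1`, and the
corresponding column of `C` alone can produce any value, so the image of `y - y'` is uniform. -/
theorem prob_linearHash_eq {d s : ℕ} {y y' : Fin d → Bool} (h : y ≠ y') :
    prob (PMF.uniformOfFintype (Fin d → Fin s → Bool))
      (fun C => linearHash C y = linearHash C y') = 1 / 2 ^ s := by
  obtain ⟨i, hi⟩ := Function.ne_iff.1 h
  let f : (Fin d → Fin s → Bool) →+ (Fin s → Bool) :=
    AddMonoidHom.mk' (fun C => linearHash C (y - y')) (fun C C' => by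
      funext j; simp [linearHash, add_mul, Finset.sum_add_distrib])
  have hf : Function.Surjective f := fun v => by
    refine ⟨fun i' j => if i' = i then v j else 0, ?_⟩
    have e : y i - y' i = 1 := by
      revert hi; cases y i <;> cases y' i <;> decide
    funext j
    simp [f, linearHash, ite_mul, e]
  have e : (fun C : Fin d → Fin s → Bool => linearHash C y = linearHash C y') =
      fun C => f C = 0 := by
    funext C
    have : f C = linearHash C y - linearHash C y' := by
      funext j
      simp [f, linearHash, mul_sub]
    rw [this, sub_eq_zero]
  rw [e, prob_uniform_comp_surjective f hf (fun v => v = 0), prob_uniform]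
  simp [Finset.filter_eq']

theorem le_prob_injOn_linearHash {d : ℕ} (s : ℕ) (Y : Finset (Fin d → Bool)) :
    1 - (Y.card : ℝ) ^ 2 / 2 ^ s ≤ prob (PMF.uniformOfFintype (Fin d → Fin s → Bool))
      (fun C => Set.InjOn (linearHash C) Y) := by
  classical
  refine le_trans ?_ (prob_not _ _)
  have h1 : prob (PMF.uniformOfFintype (Fin d → Fin s → Bool))
      (fun C => ¬ Set.InjOn (linearHash C) Y) ≤ ∑ q ∈ Y.offDiag, 1 / 2 ^ s := by
    refine le_trans (prob_mono _ ?_) ((prob_exists_le_sum _ Y.offDiag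
      (fun q C => linearHash C q.1 = linearHash C q.2)).trans (Finset.sum_le_sum fun q hq =>
        (prob_linearHash_eq (Finset.mem_offDiag.1 hq).2.2).le))
    intro C _ hC
    simp only [Set.InjOn, not_forall] at hC
    obtain ⟨a, ha, b, hb, hab, hne⟩ := hC
    exact ⟨(a, b), by simp_all, hab⟩
  have h2 : (Y.offDiag.card : ℝ) ≤ (Y.card : ℝ) ^ 2 := by
    rw [Finset.offDiag_card, sq]; exact_mod_cast Nat.sub_le _ _
  rw [Finset.sum_const, nsmul_eq_mul, mul_one_div] at h1
  have := div_le_div_of_nonneg_right h2 (by positivity : (0 : ℝ) ≤ 2 ^ s)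
  linarith

/-! ### Isolation by a random function -/

/-- For each `u ∈ U`, the functions sending `u` into `Q` and the rest of `U` outside `Q` form a box
`B u`. These boxes are disjoint and of equal size, and lie in the event. -/
theorem prob_existsUnique_random_function {V W : Type*} [Fintype V] [DecidableEq V] [Fintype W]
    [Nonempty W] (U : Finset V) (Q : Finset W) :
    (U.card : ℝ) * (((Q.card : ℝ) / Fintype.card W) *
      (1 - (Q.card : ℝ) / Fintype.card W) ^ (U.card - 1)) ≤
    prob (PMF.uniformOfFintype (V → W)) (fun T => ∃! u, u ∈ U ∧ T u ∈ Q) := by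
  classical
  have hW : (0 : ℝ) < Fintype.card W := by exact_mod_cast Fintype.card_pos
  let B (u v : V) : Finset W := if v = u then Q else if v ∈ U then Qᶜ else Finset.univ
  have hsub : U.biUnion (fun u => Fintype.piFinset (B u)) ⊆
      Finset.univ.filter (fun T : V → W => ∃! u, u ∈ U ∧ T u ∈ Q) := by
    intro T hT
    obtain ⟨u, hu, hT⟩ := Finset.mem_biUnion.1 hT
    rw [Fintype.mem_piFinset] at hT
    refine Finset.mem_filter.2 ⟨Finset.mem_univ _, u, ⟨hu, by simpa [B] using hT u⟩, ?_⟩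
    rintro v ⟨hv, hvQ⟩
    by_contra hvu
    have := hT v
    simp [B, hvu, hv, hvQ] at this
  have hdisj : Set.PairwiseDisjoint (U : Set V) fun u => Fintype.piFinset (B u) := by
    intro u hu v hv huv
    refine Finset.disjoint_left.2 fun T hT hT' => ?_
    have h1 := Fintype.mem_piFinset.1 hT u
    have h2 := Fintype.mem_piFinset.1 hT' u
    have hu' : u ∈ U := hu
    simp [B, huv, hu'] at h1 h2
    exact h2 h1
  have hcard (u : V) (hu : u ∈ U) : ((Fintype.piFinset (B u)).card : ℝ) =
      Fintype.card (V → W) * (((Q.card : ℝ) / Fintype.card W) *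
        (1 - (Q.card : ℝ) / Fintype.card W) ^ (U.card - 1)) := by
    have e (v : V) : ((B u v).card : ℝ) = Fintype.card W * (if v = u then
        (Q.card : ℝ) / Fintype.card W else
          if v ∈ U then 1 - (Q.card : ℝ) / Fintype.card W else 1) := by
      simp only [B]
      split_ifs
      · field_simp
      · rw [Finset.card_compl, Nat.cast_sub (Finset.card_le_univ _)]; field_simp
      · simp [Finset.card_univ]
    rw [Fintype.card_piFinset]
    push_cast
    simp only [e]
    rw [Finset.prod_mul_distrib, Finset.prod_const, Fintype.card_fun, Finset.card_univ,
      ← Finset.mul_prod_erase _ _ (Finset.mem_univ u)]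
    push_cast
    congr 2
    · simp
    · rw [← Finset.card_erase_of_mem hu, ← Finset.prod_const]
      symm
      rw [← Finset.prod_subset (Finset.erase_subset_erase u (Finset.subset_univ U))]
      · refine Finset.prod_congr rfl fun v hv => ?_
        have := Finset.mem_erase.1 hv
        simp [this.1, this.2]
      · intro v hv hv'
        simp at hv hv'
        simp [hv, hv' hv]
  rw [prob_uniform, le_div_iff₀ (by exact_mod_cast Fintype.card_pos)]
  refine le_trans (le_of_eq ?_) (Nat.cast_le.2 (Finset.card_le_card hsub))
  rw [Finset.card_biUnion hdisj]
  push_cast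
  rw [Finset.sum_congr rfl hcard, Finset.sum_const, nsmul_eq_mul]
  ring

/-- A threshold for `N`-bit strings that accepts a fraction of about `1 / k` of them. -/
theorem exists_precision (K : ℕ) : ∃ N : ℕ, ∀ k, 2 ≤ k → k ≤ K →
    0 ≤ (k : ℝ) * (((2 ^ N / k : ℕ) / 2 ^ N : ℝ) * (1 - ((2 ^ N / k : ℕ) / 2 ^ N : ℝ)) ^ (k - 1)) ∧
    Real.exp (-1) ≤ (1 - (k : ℝ) ^ 2 / 2 ^ N) *
      ((k : ℝ) * (((2 ^ N / k : ℕ) / 2 ^ N : ℝ) * (1 - ((2 ^ N / k : ℕ) / 2 ^ N : ℝ)) ^ (k - 1))) := by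
  open Filter Topology in
  have hp : Tendsto (fun N : ℕ => (2 : ℝ) ^ N) atTop atTop :=
    tendsto_pow_atTop_atTop_of_one_lt one_lt_two
  have key (k : ℕ) (hk : 2 ≤ k) : ∀ᶠ N : ℕ in atTop, Real.exp (-1) ≤ (1 - (k : ℝ) ^ 2 / 2 ^ N) *
      ((k : ℝ) * (((2 ^ N / k : ℕ) / 2 ^ N : ℝ) * (1 - ((2 ^ N / k : ℕ) / 2 ^ N : ℝ)) ^ (k - 1))) := by
    have hk0 : (0 : ℝ) < k := by positivity
    have hq : Tendsto (fun N : ℕ => ((2 ^ N / k : ℕ) / 2 ^ N : ℝ)) atTop (𝓝 (1 / k)) := by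
      have := (tendsto_nat_floor_mul_div_atTop (R := ℝ) (a := 1 / k) (by positivity)).comp hp
      refine this.congr fun N => ?_
      simp only [Function.comp]
      congr 2
      rw [one_div_mul_eq_div, Nat.floor_div_natCast]
      congr 1
      exact_mod_cast Nat.floor_natCast (R := ℝ) (2 ^ N)
    have hlim := ((tendsto_const_nhds (x := (1 : ℝ))).sub (hp.const_div_atTop ((k : ℝ) ^ 2))).mul
      ((hq.mul (((tendsto_const_nhds (x := (1 : ℝ))).sub hq).pow (k - 1))).const_mul (k : ℝ))
    -- With `k = j + 1` the limit is `(1 + 1/j)^(-j)`, and `(1 + 1/j)^j < e` strictly; the gap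
    -- absorbs both the rounding and the collision loss at a finite `N`.
    refine (hlim.eventually_const_lt ?_).mono fun _ h => h.le
    obtain ⟨j, rfl⟩ : ∃ j, k = j + 1 := ⟨k - 1, by omega⟩
    have hj : (0 : ℝ) < j := by
      have : 0 < j := by omega
      exact_mod_cast this
    have h1 : (1 + 1 / (j : ℝ)) ^ j < Real.exp 1 := by
      have := pow_lt_pow_left₀ (by linarith [Real.add_one_lt_exp (by positivity : 1 / (j : ℝ) ≠ 0)] :
        1 + 1 / (j : ℝ) < Real.exp (1 / j)) (by positivity) (by omega : j ≠ 0)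
      rwa [← Real.exp_nat_mul, mul_one_div_cancel hj.ne'] at this
    have h2 : 1 - 1 / ((j + 1 : ℕ) : ℝ) = (1 + 1 / (j : ℝ))⁻¹ := by
      push_cast; field_simp; ring
    rw [h2, Real.exp_neg, sub_zero, one_mul, ← mul_assoc, mul_one_div_cancel hk0.ne', one_mul,
      Nat.add_sub_cancel, inv_pow]
    exact inv_strictAnti₀ (by positivity) h1
  have hall : ∀ᶠ N : ℕ in atTop, ∀ k ∈ Finset.Icc 2 K, Real.exp (-1) ≤
      (1 - (k : ℝ) ^ 2 / 2 ^ N) * ((k : ℝ) * (((2 ^ N / k : ℕ) / 2 ^ N : ℝ) *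
        (1 - ((2 ^ N / k : ℕ) / 2 ^ N : ℝ)) ^ (k - 1))) :=
    (Filter.eventually_all_finset _).2 fun k hk => key k (Finset.mem_Icc.1 hk).1
  obtain ⟨N, hN⟩ := hall.exists
  refine ⟨N, fun k h2 hK => ⟨?_, hN k (Finset.mem_Icc.2 ⟨h2, hK⟩)⟩⟩
  have h : ((2 ^ N / k : ℕ) / 2 ^ N : ℝ) ≤ 1 := by
    rw [div_le_one (by positivity)]
    exact_mod_cast Nat.div_le_self _ _
  have := sub_nonneg.2 h
  positivity

/-- A random matrix followed by a random table isolates one of `k` distinct points with probability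
at least `1 / e`, if the table accepts with a suitable probability. -/
theorem exists_isolating_tables (K : ℕ) : ∃ (N : ℕ) (Q : ℕ → Finset (Fin N → Bool)),
    ∀ (d : ℕ) (Y : Finset (Fin d → Bool)), 2 ≤ Y.card → Y.card ≤ K →
      Real.exp (-1) ≤ prob (PMF.uniformOfFintype
        (((Fin N → Bool) → Fin N → Bool) × (Fin d → Fin N → Bool)))
        (fun q => ∃! y, y ∈ Y ∧ q.1 (linearHash q.2 y) ∈ Q Y.card) := by
  classical
  obtain ⟨N, hN⟩ := exists_precision K
  have hQ (k : ℕ) : ∃ Q : Finset (Fin N → Bool), Q.card = 2 ^ N / k := by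
    obtain ⟨Q, -, h⟩ := Finset.exists_subset_card_eq (s := (Finset.univ : Finset (Fin N → Bool)))
      (n := 2 ^ N / k) (by simpa using Nat.div_le_self _ _)
    exact ⟨Q, h⟩
  choose Q hQ using hQ
  refine ⟨N, Q, fun d Y h2 hK => ?_⟩
  obtain ⟨h0, he⟩ := hN _ h2 hK
  -- Condition on the matrix being injective on `Y`: the hashed set then still has `Y.card`
  -- elements, the size for which `Q Y.card` was chosen.
  refine he.trans (mul_le_prob_uniform_prod _ (fun C => Set.InjOn (linearHash C) Y) h0
    (le_prob_injOn_linearHash N Y) fun C hC => ?_)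
  have := prob_existsUnique_random_function (Y.image (linearHash C)) (Q Y.card)
  rw [Finset.card_image_of_injOn hC, hQ] at this
  simp only [Fintype.card_fun, Fintype.card_bool, Fintype.card_fin, Nat.cast_pow,
    Nat.cast_ofNat] at this
  refine this.trans (prob_mono _ ?_)
  rintro T - ⟨u, ⟨hu, hT⟩, huni⟩
  obtain ⟨y, hy, rfl⟩ := Finset.mem_image.1 hu
  exact ⟨y, ⟨hy, hT⟩, fun y' ⟨hy', hT'⟩ => hC hy' hy
    (huni _ ⟨Finset.mem_image_of_mem _ hy', hT'⟩)⟩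

/-! ### A polynomial-time machine for the hashing attack -/

namespace AttackMachine

open Turing TM2 Stmt

/-- The stacks: input, output, the reversed output, and two unary counters. -/
inductive Stack where
  | inp | out | rev | cnt | aux
  deriving DecidableEq

instance : Fintype Stack := ⟨{.inp, .out, .rev, .cnt, .aux}, by rintro (_ | _) <;> decide⟩

/-- The alphabets of the stacks. -/
abbrev Alphabet : Stack → Type
  | .inp => TapeSym ⊕ Bool
  | .out | .rev | .cnt | .aux => TapeSym

/-- The labels: read the record length; read the count of an entry; skip or copy its circuit; drop
the rest of the release; hash one coordinate; copy the counter up and down; discard unused coins;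
reverse the output. -/
inductive Label where
  | size | entry | skip | copy | drop | loop | up | down | wipe | out
  deriving DecidableEq

instance : Fintype Label :=
  ⟨{.size, .entry, .skip, .copy, .drop, .loop, .up, .down, .wipe, .out}, by
    rintro (_ | _) <;> decide⟩

/-- The internal memory: the last symbol read, a count capped at `K + 1`, and two blocks of coin
flips. -/
@[ext]
structure Mem (K R s : ℕ) where
  sym : Option (TapeSym ⊕ Bool)
  count : Fin (K + 2)
  table : Fin R → Bool
  col : Fin s → Bool

noncomputable instance (K R s : ℕ) : Fintype (Mem K R s) :=
  Fintype.ofInjective (fun v => (v.sym, v.count, v.table, v.col)) fun v w h => by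
    simp only [Prod.mk.injEq] at h
    exact Mem.ext h.1 h.2.1 h.2.2.1 h.2.2.2

/-- The contents of the stacks. -/
def tapes (a : List (TapeSym ⊕ Bool)) (b c d e : List TapeSym) : ∀ k, List (Alphabet k)
  | .inp => a
  | .out => b
  | .rev => c
  | .cnt => d
  | .aux => e

section Stacks

variable (a a' : List (TapeSym ⊕ Bool)) (b c d e x : List TapeSym)

@[simp] theorem tapes_inp : tapes a b c d e .inp = a := rfl
@[simp] theorem tapes_out : tapes a b c d e .out = b := rfl
@[simp] theorem tapes_rev : tapes a b c d e .rev = c := rfl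
@[simp] theorem tapes_cnt : tapes a b c d e .cnt = d := rfl
@[simp] theorem tapes_aux : tapes a b c d e .aux = e := rfl

@[simp] theorem update_inp :
    Function.update (tapes a b c d e) .inp a' = tapes a' b c d e := by
  funext k; cases k <;> rfl
@[simp] theorem update_out :
    Function.update (tapes a b c d e) .out x = tapes a x c d e := by
  funext k; cases k <;> rfl
@[simp] theorem update_rev :
    Function.update (tapes a b c d e) .rev x = tapes a b x d e := by
  funext k; cases k <;> rfl
@[simp] theorem update_cnt :
    Function.update (tapes a b c d e) .cnt x = tapes a b c x e := by
  funext k; cases k <;> rfl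
@[simp] theorem update_aux :
    Function.update (tapes a b c d e) .aux x = tapes a b c d x := by
  funext k; cases k <;> rfl

end Stacks

variable {K R s : ℕ}

abbrev Prog (K R s : ℕ) := Stmt Alphabet Label (Mem K R s)

/-- Push the symbols of `g v` from position `j` on, at most `n` of them. -/
def pushList (g : Mem K R s → List TapeSym) (q : Prog K R s) : ℕ → ℕ → Prog K R s
  | 0, _ => q
  | n + 1, j => branch (fun v => decide (j < (g v).length))
      (push Stack.rev (fun v => (g v).getD j .fin) (pushList g q n (j + 1))) q

/-- A statement is a fixed finite tree, while the string depends on memory; hence the unrolling to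
depth `n`, and `h` says that this depth suffices. -/
theorem stepAux_pushList (g : Mem K R s → List TapeSym) (q : Prog K R s) (n j : ℕ) (v : Mem K R s)
    (h : (g v).length ≤ j + n) (a : List (TapeSym ⊕ Bool)) (b c d e : List TapeSym) :
    stepAux (pushList g q n j) v (tapes a b c d e) =
      stepAux q v (tapes a b (((g v).drop j).reverse ++ c) d e) := by
  induction n generalizing j c with
  | zero => simp [pushList, List.drop_eq_nil_of_le (by omega : (g v).length ≤ j)]
  | succ n ih =>
    rw [pushList, stepAux]
    by_cases hj : j < (g v).length
    · rw [decide_eq_true hj, cond_true, stepAux, update_rev, ih _ (by omega), tapes_rev,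
        List.drop_eq_getElem_cons hj, List.getD_eq_getElem _ _ hj, List.reverse_cons,
        List.append_assoc]
      rfl
    · rw [decide_eq_false hj, cond_false, List.drop_eq_nil_of_le (by omega)]
      simp

/-- The coin flip that a popped symbol stands for. -/
def toBit : Option (TapeSym ⊕ Bool) → Bool
  | some (.inr b) => b
  | _ => false

/-- Pop `n` coin flips and store them in a block of memory from position `j` on. -/
def popBits {m : ℕ} (get : Mem K R s → Fin m → Bool) (put : (Fin m → Bool) → Mem K R s → Mem K R s)
    (q : Prog K R s) : ℕ → ℕ → Prog K R s
  | 0, _ => q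
  | n + 1, j => pop Stack.inp
      (fun v o => put (fun i => if i = j then toBit o else get v i) v) (popBits get put q n (j + 1))

/-- The laws `h₁`, `h₂`, `h₃` say that `get` and `put` address one field of memory. Popping an empty
stack yields `false`, in agreement with the default of `getD`. -/
theorem stepAux_popBits {m : ℕ} (get : Mem K R s → Fin m → Bool)
    (put : (Fin m → Bool) → Mem K R s → Mem K R s) (h₁ : ∀ f v, get (put f v) = f)
    (h₂ : ∀ f g v, put f (put g v) = put f v) (h₃ : ∀ v, put (get v) v = v) (q : Prog K R s)
    (n j : ℕ) (hj : j + n = m) (v : Mem K R s) (r : List Bool) (b c d e : List TapeSym) :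
    stepAux (popBits get put q n j) v (tapes (r.map Sum.inr) b c d e) =
      stepAux q (put (fun i => if j ≤ i then r.getD (i - j) false else get v i) v)
        (tapes ((r.drop n).map Sum.inr) b c d e) := by
  induction n generalizing j v r with
  | zero =>
    have : (fun i : Fin m => if j ≤ i then r.getD (i - j) false else get v i) = get v := by
      funext i
      rw [if_neg (by omega)]
    rw [this, h₃]; rfl
  | succ n ih =>
    have e1 : toBit (r.map Sum.inr).head? = r.getD 0 false := by cases r <;> rfl
    have e2 : (r.map Sum.inr).tail = (r.tail.map Sum.inr : List (TapeSym ⊕ Bool)) := by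
      cases r <;> rfl
    rw [popBits, stepAux, update_inp, tapes_inp, e1, e2, ih _ (by omega), h₂, h₁]
    congr 2
    · funext i
      rcases lt_trichotomy (i : ℕ) j with h | h | h
      · simp [show ¬ j + 1 ≤ (i : ℕ) by omega, show ¬ j ≤ (i : ℕ) by omega, h.ne]
      · simp [h]
      · obtain ⟨k, hk⟩ : ∃ k, (i : ℕ) = j + 1 + k := ⟨i - (j + 1), by omega⟩
        rw [if_pos (by omega), if_pos (by omega), hk, show j + 1 + k - (j + 1) = k by omega,
          show j + 1 + k - j = k + 1 by omega]
        cases r <;> simp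
    · cases r <;> simp

/-- The tape symbol of a symbol of memory. -/
def toTape : Option (TapeSym ⊕ Bool) → TapeSym
  | some (.inl a) => a
  | _ => .fin

/-- A count, capped at `K + 1`. -/
def cap (K a : ℕ) : Fin (K + 2) := ⟨min a (K + 1), by omega⟩

def popInp (q : Prog K R s) : Prog K R s := pop Stack.inp (fun v o => { v with sym := o }) q

/-- The gates that set the initial value of the hash. -/
def zeroGates (s : ℕ) : List Gate := List.replicate s (.const false)

def encGates (G : List Gate) : List TapeSym := G.flatMap encGate

/-- The program. Constant strings have length at most `B`. -/
def program (G : Fin (K + 2) → (Fin R → Bool) → List Gate) (B : ℕ) : Label → Prog K R s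
  | .size => popInp <| branch (fun v => v.sym = some (.inl .one))
      (push Stack.cnt (fun _ => .one) (goto fun _ => .size)) (goto fun _ => .entry)
  | .entry => popInp <| branch (fun v => v.sym = some (.inl .one))
      (load (fun v => { v with count := cap K (v.count + 1) }) (goto fun _ => .entry))
      (branch (fun v => v.sym = some (.inl .sep))
        (goto fun v => if (v.count : ℕ) ≤ K then .copy else .skip) (goto fun _ => .drop))
  | .skip => popInp <| branch (fun v => v.sym = some (.inl .fin))
      (load (fun v => { v with count := cap K 0 }) (goto fun _ => .entry)) (goto fun _ => .skip)
  | .copy => popInp <| branch (fun v => v.sym = some (.inl .fin))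
      (goto fun _ => .drop) (push Stack.rev (fun v => toTape v.sym) (goto fun _ => .copy))
  -- Peeking, because the release is known to be over only when a coin (or nothing) is on top, and
  -- that coin must not be lost.
  | .drop => peek Stack.inp (fun v o => { v with sym := o }) <|
      branch (fun v => v.sym.any Sum.isLeft) (popInp (goto fun _ => .drop))
        (pushList (fun _ => encGates (zeroGates s))
          (popBits Mem.table (fun t v => { v with table := t }) (goto fun _ => .loop) R 0) B 0)
  | .loop => pop Stack.cnt (fun v o => { v with sym := o.map Sum.inl }) <|
      branch (fun v => v.sym.isSome)
        (popBits Mem.col (fun t v => { v with col := t })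
          (push Stack.rev (fun _ => .inp) (goto fun _ => .up)) s 0)
        (pushList (fun v => encGates (G v.count v.table)) (goto fun _ => .wipe) B 0)
  -- Writing the input index in unary consumes the counter, so it is saved on `aux` and put back by
  -- `down`.
  | .up => pop Stack.cnt (fun v o => { v with sym := o.map Sum.inl }) <|
      branch (fun v => v.sym.isSome)
        (push Stack.rev (fun _ => .one) (push Stack.aux (fun _ => .one) (goto fun _ => .up)))
        (goto fun _ => .down)
  | .down => pop Stack.aux (fun v o => { v with sym := o.map Sum.inl }) <|
      branch (fun v => v.sym.isSome)
        (push Stack.cnt (fun _ => .one) (goto fun _ => .down))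
        (push Stack.rev (fun _ => .sep)
          (pushList (fun v => encGates (blockGates v.col)) (goto fun _ => .loop) B 0))
  | .wipe => popInp <| branch (fun v => v.sym.isSome)
      (goto fun _ => .wipe) (push Stack.rev (fun _ => .fin) (goto fun _ => .out))
  | .out => pop Stack.rev (fun v o => { v with sym := o.map Sum.inl }) <|
      branch (fun v => v.sym.isSome)
        (push Stack.out (fun v => toTape v.sym) (goto fun _ => .out))
        -- A halting configuration must have the initial memory, and every stack other than the
        -- output empty.
        (load (fun _ => ⟨none, cap K 0, fun _ => false, fun _ => false⟩) halt)

/-- The machine gets from one configuration to another in at most `t` steps. -/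
def Reaches (M : Label → Prog K R s) (c : Cfg Alphabet Label (Mem K R s)) (t : ℕ)
    (c' : Cfg Alphabet Label (Mem K R s)) : Prop :=
  ∃ n ≤ t, (flip bind (TM2.step M))^[n] (some c) = some c'

section Reaches

variable {M : Label → Prog K R s} {c c' c'' : Cfg Alphabet Label (Mem K R s)} {t t' : ℕ}

theorem Reaches.trans (h : Reaches M c t c') (h' : Reaches M c' t' c'') :
    Reaches M c (t + t') c'' := by
  obtain ⟨n, hn, e⟩ := h
  obtain ⟨n', hn', e'⟩ := h'
  exact ⟨n' + n, by omega, by rw [Function.iterate_add_apply, e, e']⟩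

theorem Reaches.mono (h : Reaches M c t c') (ht : t ≤ t') : Reaches M c t' c' := by
  obtain ⟨n, hn, e⟩ := h
  exact ⟨n, hn.trans ht, e⟩

theorem Reaches.single {l : Label} {v : Mem K R s} {S : ∀ k, List (Alphabet k)}
    (h : stepAux (M l) v S = c') : Reaches M ⟨some l, v, S⟩ 1 c' := by
  refine ⟨1, le_rfl, ?_⟩
  subst h; rfl

theorem Reaches.head {l : Label} {v : Mem K R s} {S : ∀ k, List (Alphabet k)}
    (h : stepAux (M l) v S = c') (h' : Reaches M c' t c'') :
    Reaches M ⟨some l, v, S⟩ (t + 1) c'' :=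
  ((Reaches.single h).trans h').mono (by omega)

end Reaches

/-! ### Effect and running time of each phase of the program -/

section Phases

variable (G : Fin (K + 2) → (Fin R → Bool) → List Gate) (B : ℕ)

theorem reaches_size (n : ℕ) (y k T c) (a : List (TapeSym ⊕ Bool)) (o v d e : List TapeSym) :
    Reaches (program (s := s) G B) ⟨some .size, ⟨y, k, T, c⟩,
      tapes ((encNat n).map Sum.inl ++ a) o v d e⟩ (n + 1)
      ⟨some .entry, ⟨some (.inl .sep), k, T, c⟩,
        tapes a o v (List.replicate n .one ++ d) e⟩ := by
  induction n generalizing y d with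
  | zero => exact Reaches.single (by simp [program, popInp, encNat])
  | succ n ih =>
    refine Reaches.head (c' := ⟨some .size, ⟨some (.inl .one), k, T, c⟩,
      tapes ((encNat n).map Sum.inl ++ a) o v (.one :: d) e⟩) ?_ ?_
    · simp [program, popInp, encNat, List.replicate_succ]
    · have h := ih (some (.inl .one)) (.one :: d)
      rwa [show List.replicate n TapeSym.one ++ .one :: d =
        List.replicate (n + 1) TapeSym.one ++ d by simp [List.replicate_succ']] at h

/-- Capping at `K + 1` commutes with counting and does not affect the test `≤ K`, so finite memory
suffices for unbounded counts. -/
theorem reaches_count (n m : ℕ) (y T c) (a : List (TapeSym ⊕ Bool)) (o v d e : List TapeSym) :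
    Reaches (program (s := s) G B) ⟨some .entry, ⟨y, cap K m, T, c⟩,
      tapes ((encNat n).map Sum.inl ++ a) o v d e⟩ (n + 1)
      ⟨some (if m + n ≤ K then .copy else .skip), ⟨some (.inl .sep), cap K (m + n), T, c⟩,
        tapes a o v d e⟩ := by
  induction n generalizing y m with
  | zero =>
    refine Reaches.single ?_
    have : (cap K m : ℕ) ≤ K ↔ m ≤ K := by simp [cap]
    simp [program, popInp, encNat, this]
  | succ n ih =>
    refine Reaches.head (c' := ⟨some .entry, ⟨some (.inl .one), cap K (m + 1), T, c⟩,
      tapes ((encNat n).map Sum.inl ++ a) o v d e⟩) ?_ ?_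
    · have : cap K ((cap K m : ℕ) + 1) = cap K (m + 1) := by
        apply Fin.ext; simp only [cap]; omega
      simp [program, popInp, encNat, List.replicate_succ, this]
    · have := ih (m + 1) (some (.inl .one))
      rwa [show m + 1 + n = m + (n + 1) by omega] at this

theorem reaches_skip (w : List TapeSym) (hw : ∀ a ∈ w, a ≠ .fin) (y k T c)
    (a : List (TapeSym ⊕ Bool)) (o v d e : List TapeSym) :
    Reaches (program (s := s) G B) ⟨some .skip, ⟨y, k, T, c⟩,
      tapes ((w ++ [TapeSym.fin]).map Sum.inl ++ a) o v d e⟩ (w ++ [TapeSym.fin]).length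
      ⟨some .entry, ⟨some (.inl .fin), cap K 0, T, c⟩, tapes a o v d e⟩ := by
  induction w generalizing y with
  | nil => exact Reaches.single (by simp [program, popInp])
  | cons b w ih =>
    refine Reaches.head ?_ (ih (fun a h => hw a (by simp [h])) (some (.inl b)))
    have := hw b (by simp)
    simp [program, popInp, this]

theorem reaches_copy (w : List TapeSym) (hw : ∀ a ∈ w, a ≠ .fin) (y k T c)
    (a : List (TapeSym ⊕ Bool)) (o v d e : List TapeSym) :
    Reaches (program (s := s) G B) ⟨some .copy, ⟨y, k, T, c⟩,
      tapes ((w ++ [TapeSym.fin]).map Sum.inl ++ a) o v d e⟩ (w ++ [TapeSym.fin]).length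
      ⟨some .drop, ⟨some (.inl .fin), k, T, c⟩, tapes a o (w.reverse ++ v) d e⟩ := by
  induction w generalizing y v with
  | nil => exact Reaches.single (by simp [program, popInp])
  | cons b w ih =>
    have h := ih (fun a h => hw a (by simp [h])) (some (.inl b)) (b :: v)
    rw [show w.reverse ++ b :: v = (b :: w).reverse ++ v by simp] at h
    refine Reaches.head ?_ h
    have := hw b (by simp)
    simp [program, popInp, this, toTape]

/-- The first entry of a release whose count is at most `K`. -/
def firstEntry (K : ℕ) (L : List (ℕ × Circuit)) : ℕ × Circuit :=
  (L.find? fun e => decide (e.1 ≤ K)).getD (0, [])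

/-- The entries of a release, as written on a tape. -/
def encEntries (L : List (ℕ × Circuit)) : List TapeSym :=
  L.flatMap fun e => encNat e.1 ++ encCircuit e.2

/-- This makes `fin` a reliable end marker: circuits can be skipped or copied without being parsed.
-/
theorem fin_notMem_encGates (C : List Gate) : ∀ a ∈ encGates C, a ≠ .fin := by
  intro a ha
  obtain ⟨g, -, hg⟩ := List.mem_flatMap.1 ha
  rintro rfl
  rcases g with i | (_ | _) | i | ⟨i, j⟩ | ⟨i, j⟩ | ⟨i, j⟩ <;> simp [encGate, encNat] at hg

theorem reaches_search (L : List (ℕ × Circuit)) (y T c) (r : List Bool) (o v d e : List TapeSym) :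
    ∃ (y' : Option (TapeSym ⊕ Bool)) (w' : List TapeSym),
      w'.length ≤ (encEntries L).length + 1 ∧
      Reaches (program (s := s) G B) ⟨some .entry, ⟨y, cap K 0, T, c⟩,
        tapes ((encEntries L ++ [TapeSym.fin]).map Sum.inl ++
          r.map Sum.inr) o v d e⟩
        ((encEntries L).length + 1)
        ⟨some .drop, ⟨y', cap K (firstEntry K L).1, T, c⟩, tapes (w'.map Sum.inl ++ r.map Sum.inr)
          o ((encGates (firstEntry K L).2).reverse ++ v) d e⟩ := by
  induction L generalizing y with
  | nil =>
    -- No entry qualifies: nothing is copied and the count is still `0`, as in the default of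
    -- `firstEntry`.
    exact ⟨some (.inl .fin), [], by simp, Reaches.single (by
      simp [program, popInp, firstEntry, encGates, encEntries])⟩
  | cons q L ih =>
    obtain ⟨n, C⟩ := q
    have h := reaches_count (s := s) G B n 0 y T c ((encCircuit C ++
      (encEntries L ++ [TapeSym.fin])).map Sum.inl ++ r.map Sum.inr)
      o v d e
    rw [zero_add] at h
    have e1 : ((encEntries ((n, C) :: L) ++ [TapeSym.fin]).map
        Sum.inl ++ r.map Sum.inr : List (TapeSym ⊕ Bool)) = (encNat n).map Sum.inl ++
          ((encCircuit C ++ (encEntries L ++ [TapeSym.fin])).map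
            Sum.inl ++ r.map Sum.inr) := by simp [encEntries]
    have e2 : (encEntries ((n, C) :: L)).length =
        (n + 1) + (encGates C ++ [TapeSym.fin]).length +
          (encEntries L).length := by
      simp [encNat, encCircuit, encGates, encEntries]; omega
    rw [e1, e2]
    rw [List.map_append, List.append_assoc] at h ⊢
    by_cases hn : n ≤ K
    · rw [if_pos hn] at h
      have h' := reaches_copy (s := s) G B (encGates C) (fin_notMem_encGates C)
        (some (.inl .sep)) (cap K n) T c
        ((encEntries L ++ [TapeSym.fin]).map Sum.inl ++ r.map Sum.inr)
        o v d e
      refine ⟨some (.inl .fin), encEntries L ++ [.fin], ?_, ?_⟩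
      · simp
      · have : firstEntry K ((n, C) :: L) = (n, C) := by simp [firstEntry, hn]
        rw [this]
        exact (h.trans h').mono (by omega)
    · rw [if_neg hn] at h
      have h' := reaches_skip (s := s) G B (encGates C) (fin_notMem_encGates C)
        (some (.inl .sep)) (cap K n) T c
        ((encEntries L ++ [TapeSym.fin]).map Sum.inl ++ r.map Sum.inr)
        o v d e
      obtain ⟨y', w', hl, h''⟩ := ih (some (.inl .fin))
      refine ⟨y', w', by omega, ?_⟩
      have : firstEntry K ((n, C) :: L) = firstEntry K L := by simp [firstEntry, hn]
      rw [this]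
      exact ((h.trans h').trans h'').mono (by omega)

theorem reaches_drop (hB : (encGates (zeroGates s)).length ≤ B) (w : List TapeSym) (y k T c)
    (r : List Bool) (o v d e : List TapeSym) :
    ∃ y', Reaches (program (s := s) G B) ⟨some .drop, ⟨y, k, T, c⟩,
      tapes (w.map Sum.inl ++ r.map Sum.inr) o v d e⟩ (w.length + 1)
      ⟨some .loop, ⟨y', k, fun i => r.getD i false, c⟩,
        tapes ((r.drop R).map Sum.inr) o ((encGates (zeroGates s)).reverse ++ v) d e⟩ := by
  induction w generalizing y with
  | nil =>
    refine ⟨(r.map Sum.inr).head?, Reaches.single ?_⟩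
    have : ((r.map Sum.inr).head? : Option (TapeSym ⊕ Bool)).any Sum.isLeft = false := by
      cases r <;> rfl
    simp only [program, stepAux, List.map_nil, List.nil_append, tapes_inp, this, cond_false]
    rw [stepAux_pushList _ _ _ _ _ (by simpa using hB), stepAux_popBits Mem.table
      (fun t v => { v with table := t }) (fun _ _ => rfl) (fun _ _ _ => rfl) (fun _ => rfl) _ _ _
      (by simp)]
    simp
  | cons b w ih =>
    obtain ⟨y', h⟩ := ih (some (.inl b))
    exact ⟨y', Reaches.head (by simp [program, popInp]) h⟩

theorem reaches_up (n : ℕ) (y k T c) (a : List (TapeSym ⊕ Bool)) (o v e : List TapeSym) :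
    Reaches (program (s := s) G B) ⟨some .up, ⟨y, k, T, c⟩,
      tapes a o v (List.replicate n .one) e⟩ (n + 1)
      ⟨some .down, ⟨none, k, T, c⟩,
        tapes a o (List.replicate n .one ++ v) [] (List.replicate n .one ++ e)⟩ := by
  induction n generalizing y v e with
  | zero => exact Reaches.single (by simp [program])
  | succ n ih =>
    have h := ih (some (.inl .one)) (.one :: v) (.one :: e)
    have e1 (u : List TapeSym) : List.replicate n TapeSym.one ++ .one :: u =
        List.replicate (n + 1) TapeSym.one ++ u := by simp [List.replicate_succ']
    rw [e1, e1] at h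
    exact Reaches.head (by simp [program, List.replicate_succ]) h

theorem reaches_down (n : ℕ) (y k T c) (hB : (encGates (blockGates c)).length ≤ B)
    (a : List (TapeSym ⊕ Bool)) (o v d : List TapeSym) :
    Reaches (program (s := s) G B) ⟨some .down, ⟨y, k, T, c⟩,
      tapes a o v d (List.replicate n .one)⟩ (n + 1)
      ⟨some .loop, ⟨none, k, T, c⟩, tapes a o ((encGates (blockGates c)).reverse ++ .sep :: v)
        (List.replicate n .one ++ d) []⟩ := by
  induction n generalizing y d with
  | zero =>
    refine Reaches.single ?_
    simp only [program, stepAux, tapes_aux, tapes_rev, update_aux, update_rev]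
    simp only [List.replicate_zero, List.head?_nil, Option.map_none, Option.isSome_none, cond_false]
    rw [stepAux_pushList _ _ _ _ _ (by simpa using hB)]
    simp
  | succ n ih =>
    have h := ih (some (.inl .one)) (.one :: d)
    rw [show List.replicate n TapeSym.one ++ .one :: d =
        List.replicate (n + 1) TapeSym.one ++ d by simp [List.replicate_succ']] at h
    exact Reaches.head (by simp [program, List.replicate_succ]) h

/-- A round with `n` marks left after its pop takes `1 + 2 (n + 1)` steps, one pop and two passes
over the counter. This equals `(n + 2)² - (n + 1)²`, whence the quadratic bound. -/
theorem reaches_loop (hB : ∀ c : Fin s → Bool, (encGates (blockGates c)).length ≤ B)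
    (hG : ∀ k T, (encGates (G k T)).length ≤ B) (n : ℕ) (y k T c)
    (r : List Bool) (o v : List TapeSym) :
    ∃ (v' : Mem K R s) (r' : List Bool), r'.length ≤ r.length ∧
      Reaches (program (s := s) G B) ⟨some .loop, ⟨y, k, T, c⟩,
        tapes (r.map Sum.inr) o v (List.replicate n .one) []⟩ ((n + 1) ^ 2)
        ⟨some .wipe, v', tapes (r'.map Sum.inr) o
          ((encGates (hashGates s n r ++ G k T)).reverse ++ v) [] []⟩ := by
  induction n generalizing y c r v with
  | zero =>
    refine ⟨⟨none, k, T, c⟩, r, le_rfl, Reaches.single ?_⟩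
    simp only [program, stepAux, tapes_cnt, update_cnt]
    simp only [List.replicate_zero, List.head?_nil, Option.map_none, Option.isSome_none, cond_false]
    rw [stepAux_pushList _ _ _ _ _ (by simpa using hG k T)]
    simp [hashGates]
  | succ n ih =>
    set c' : Fin s → Bool := fun j => r.getD j false with hc'
    have h1 : Reaches (program (s := s) G B) ⟨some .loop, ⟨y, k, T, c⟩,
        tapes (r.map Sum.inr) o v (List.replicate (n + 1) .one) []⟩ 1
        ⟨some .up, ⟨some (.inl .one), k, T, c'⟩, tapes ((r.drop s).map Sum.inr) o (.inp :: v)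
          (List.replicate n .one) []⟩ := by
      refine Reaches.single ?_
      simp only [program, stepAux, tapes_cnt, update_cnt, List.replicate_succ]
      simp only [List.head?_cons, Option.map_some, Option.isSome_some, cond_true, List.tail_cons]
      rw [stepAux_popBits Mem.col (fun t v => { v with col := t }) (fun _ _ => rfl)
        (fun _ _ _ => rfl) (fun _ => rfl) _ _ _ (by simp)]
      simp [hc']
    have h2 := reaches_up (s := s) G B n (some (.inl .one)) k T c' ((r.drop s).map Sum.inr) o
      (.inp :: v) []
    have h3 := reaches_down (s := s) G B n none k T c' (hB c') ((r.drop s).map Sum.inr) o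
      (List.replicate n .one ++ .inp :: v) []
    rw [List.append_nil] at h2 h3
    obtain ⟨v', r', hr, h4⟩ := ih none c' (r.drop s) ((encGates (blockGates c')).reverse ++
      .sep :: (List.replicate n .one ++ .inp :: v))
    refine ⟨v', r', hr.trans (by simp), ?_⟩
    have e1 : (encGates (hashGates s (n + 1) r ++ G k T)).reverse ++ v =
        (encGates (hashGates s n (r.drop s) ++ G k T)).reverse ++
          ((encGates (blockGates c')).reverse ++
            .sep :: (List.replicate n .one ++ .inp :: v)) := by
      simp [hashGates, encGates, encGate, encNat, hc']
    rw [e1]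
    exact (((h1.trans h2).trans h3).trans h4).mono (by ring_nf; omega)

theorem reaches_wipe (v : Mem K R s) (r : List Bool) (o u d e : List TapeSym) :
    ∃ v', Reaches (program (s := s) G B) ⟨some .wipe, v, tapes (r.map Sum.inr) o u d e⟩
      (r.length + 1) ⟨some .out, v', tapes [] o (.fin :: u) d e⟩ := by
  induction r generalizing v with
  | nil => exact ⟨_, Reaches.single (by simp only [program, popInp, stepAux]; simp; rfl)⟩
  | cons b r ih =>
    obtain ⟨v', h⟩ := ih { v with sym := some (.inr b) }
    exact ⟨v', Reaches.head (by simp [program, popInp]) h⟩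

theorem reaches_out (v : Mem K R s) (o u d e : List TapeSym) :
    Reaches (program (s := s) G B) ⟨some .out, v, tapes [] o u d e⟩ (u.length + 1)
      ⟨none, ⟨none, cap K 0, fun _ => false, fun _ => false⟩,
        tapes [] (u.reverse ++ o) [] d e⟩ := by
  induction u generalizing v o with
  | nil => exact Reaches.single (by simp [program])
  | cons b u ih =>
    have h := ih { v with sym := some (.inl b) } (b :: o)
    rw [show u.reverse ++ b :: o = (b :: u).reverse ++ o by simp] at h
    exact Reaches.head (by simp [program, toTape]) h

end Phases

/-- The circuit that the machine writes. -/
def attackCircuit (G : Fin (K + 2) → (Fin R → Bool) → List Gate) (s : ℕ)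
    (p : Release × List Bool) : Circuit :=
  (firstEntry K p.1.2).2 ++ zeroGates s ++ hashGates s p.1.1 (p.2.drop R) ++
    G (cap K (firstEntry K p.1.2).1) (fun i => p.2.getD i false)

theorem length_firstEntry (L : List (ℕ × Circuit)) :
    (encGates (firstEntry K L).2).length ≤ (encEntries L).length := by
  rcases h : L.find? (fun e => decide (e.1 ≤ K)) with _ | e
  · simp [firstEntry, h, encGates]
  · have he := List.mem_of_find?_eq_some h
    simp only [firstEntry, h, Option.getD_some]
    refine le_trans ?_ ((List.sublist_flatten_of_mem (List.mem_map_of_mem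
      (f := fun e : ℕ × Circuit => encNat e.1 ++ encCircuit e.2) he)).length_le.trans
        (le_of_eq ?_))
    · simp [encGates, encCircuit]; omega
    · rw [encEntries, List.flatMap]

theorem length_hashGates {B : ℕ} (hB : ∀ c : Fin s → Bool, (encGates (blockGates c)).length ≤ B)
    (n : ℕ) (r : List Bool) : (encGates (hashGates s n r)).length ≤ n * (n + 1 + B) := by
  induction n generalizing r with
  | zero => simp [hashGates, encGates]
  | succ n ih =>
    have h1 := ih (r.drop s)
    have h2 := hB fun j => r.getD j false
    simp only [encGates, hashGates, List.flatMap_cons, List.flatMap_append, encGate, encNat,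
      List.length_append, List.length_cons, List.length_replicate, List.length_nil] at *
    nlinarith

/-- The machine that runs the program. -/
noncomputable def machine (G : Fin (K + 2) → (Fin R → Bool) → List Gate) (s B : ℕ) : FinTM2 where
  K := Stack
  k₀ := .inp
  k₁ := .out
  Γ := Alphabet
  Λ := Label
  main := .size
  σ := Mem K R s
  initialState := ⟨none, cap K 0, fun _ => false, fun _ => false⟩
  Γk₀Fin := inferInstanceAs (Fintype (TapeSym ⊕ Bool))
  m := program G B

theorem reaches_attackCircuit (G : Fin (K + 2) → (Fin R → Bool) → List Gate) (B : ℕ)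
    (h₀ : (encGates (zeroGates s)).length ≤ B)
    (h₁ : ∀ c : Fin s → Bool, (encGates (blockGates c)).length ≤ B)
    (h₂ : ∀ k T, (encGates (G k T)).length ≤ B) (p : Release × List Bool) (N : ℕ)
    (hN : N = ((encRelease p.1).map Sum.inl ++ p.2.map (Sum.inr : Bool → TapeSym ⊕ Bool)).length) :
    Reaches (program (s := s) G B) ⟨some .size, ⟨none, cap K 0, fun _ => false, fun _ => false⟩,
      tapes ((encRelease p.1).map Sum.inl ++ p.2.map Sum.inr) [] [] [] []⟩
      ((N + 1) ^ 2 + N * (N + 1 + B) + 6 * N + 2 * B + 10)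
      ⟨none, ⟨none, cap K 0, fun _ => false, fun _ => false⟩,
        tapes [] (encCircuit (attackCircuit G s p)) [] [] []⟩ := by
  obtain ⟨⟨d, L⟩, r⟩ := p
  have e : ((encRelease (d, L)).map Sum.inl ++ r.map Sum.inr : List (TapeSym ⊕ Bool)) =
      (encNat d).map Sum.inl ++
        ((encEntries L ++ [TapeSym.fin]).map Sum.inl ++ r.map Sum.inr) := by
    simp [encRelease, encEntries]
  have hN' : N = d + 1 + ((encEntries L).length + 1 + r.length) := by
    rw [hN, e]; simp [encNat]; omega
  simp only [e]
  have s1 := reaches_size (s := s) G B d none (cap K 0) (fun _ => false) (fun _ => false)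
    ((encEntries L ++ [TapeSym.fin]).map Sum.inl ++ r.map Sum.inr) [] [] [] []
  rw [List.append_nil] at s1
  obtain ⟨y, w, hw, s2⟩ := reaches_search (s := s) G B L (some (.inl .sep)) (fun _ => false)
    (fun _ => false) r [] [] (List.replicate d .one) []
  rw [List.append_nil] at s2
  obtain ⟨y', s3⟩ := reaches_drop (s := s) G B h₀ w y (cap K (firstEntry K L).1) (fun _ => false)
    (fun _ => false) r [] (encGates (firstEntry K L).2).reverse (List.replicate d .one) []
  obtain ⟨v', r', hr, s4⟩ := reaches_loop (s := s) G B h₁ h₂ d y' (cap K (firstEntry K L).1)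
    (fun i => r.getD i false) (fun _ => false) (r.drop R) []
    ((encGates (zeroGates s)).reverse ++ (encGates (firstEntry K L).2).reverse)
  obtain ⟨v'', s5⟩ := reaches_wipe (s := s) G B v' r' [] ((encGates (hashGates s d (r.drop R) ++
    G (cap K (firstEntry K L).1) (fun i => r.getD i false))).reverse ++
    ((encGates (zeroGates s)).reverse ++ (encGates (firstEntry K L).2).reverse)) [] []
  have s6 := reaches_out (s := s) G B v'' [] (.fin :: ((encGates (hashGates s d (r.drop R) ++
    G (cap K (firstEntry K L).1) (fun i => r.getD i false))).reverse ++
    ((encGates (zeroGates s)).reverse ++ (encGates (firstEntry K L).2).reverse))) [] []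
  have e' : (TapeSym.fin :: ((encGates (hashGates s d (r.drop R) ++
      G (cap K (firstEntry K L).1) (fun i => r.getD i false))).reverse ++
      ((encGates (zeroGates s)).reverse ++ (encGates (firstEntry K L).2).reverse))).reverse ++ [] =
      encCircuit (attackCircuit G s ((d, L), r)) := by
    simp [attackCircuit, encCircuit, encGates]
  rw [e'] at s6
  refine (((((s1.trans s2).trans s3).trans s4).trans s5).trans s6).mono ?_
  have l1 := length_firstEntry (K := K) L
  have l2 := length_hashGates h₁ d (r.drop R)
  have l3 := h₂ (cap K (firstEntry K L).1) (fun i => r.getD i false)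
  have l4 : d * (d + 1 + B) ≤ N * (N + 1 + B) := by gcongr <;> omega
  have l5 : (d + 1) ^ 2 ≤ (N + 1) ^ 2 := by gcongr; omega
  have l6 : (encGates (hashGates s d (r.drop R) ++
      G (cap K (firstEntry K L).1) (fun i => r.getD i false))).length =
      (encGates (hashGates s d (r.drop R))).length +
        (encGates (G (cap K (firstEntry K L).1) (fun i => r.getD i false))).length := by
    simp [encGates]
  have l7 : r'.length ≤ r.length := hr.trans (by simp)
  simp only [List.length_cons, List.length_append, List.length_reverse, l6]
  omega

theorem computable_attackCircuit (G : Fin (K + 2) → (Fin R → Bool) → List Gate) (s : ℕ) :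
    Nonempty (TM2ComputableInPolyTime
      (fun p : Release × List Bool => (encRelease p.1).map Sum.inl ++ p.2.map Sum.inr)
      encCircuit (attackCircuit G s)) := by
  -- There are finitely many columns and tables, so a single constant bounds all the strings written
  -- in one go.
  obtain ⟨B₁, h₁⟩ := (Set.finite_range fun c : Fin s → Bool =>
    (encGates (blockGates c)).length).bddAbove
  obtain ⟨B₂, h₂⟩ := (Set.finite_range fun q : Fin (K + 2) × (Fin R → Bool) =>
    (encGates (G q.1 q.2)).length).bddAbove
  set B := (encGates (zeroGates s)).length + B₁ + B₂
  have key := reaches_attackCircuit (s := s) G B (by omega)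
    (fun c => (h₁ ⟨c, rfl⟩).trans (by omega)) (fun k T => (h₂ ⟨(k, T), rfl⟩).trans (by omega))
  open Polynomial in
  refine ⟨{
    tm := machine G s B
    inputAlphabet := Equiv.refl _
    outputAlphabet := Equiv.refl _
    time := (X + 1) ^ 2 + X * (X + 1 + C B) + 6 * X + 2 * C B + 10
    outputsFun := fun p => ?_ }⟩
  have h := key p _ rfl
  refine ⟨⟨h.choose, ?_⟩, ?_⟩
  · have e := h.choose_spec.2
    have e1 : initList (machine G s B) (List.map (Equiv.refl (TapeSym ⊕ Bool)).invFun
        ((encRelease p.1).map Sum.inl ++ p.2.map Sum.inr)) =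
        ⟨some .size, ⟨none, cap K 0, fun _ => false, fun _ => false⟩,
          tapes ((encRelease p.1).map Sum.inl ++ p.2.map Sum.inr) [] [] [] []⟩ := by
      unfold initList
      congr 1
      funext k
      cases k
      · exact List.map_id _
      all_goals rfl
    have e2 : haltList (machine G s B) (List.map (Equiv.refl TapeSym).invFun
        (encCircuit (attackCircuit G s p))) =
        ⟨none, ⟨none, cap K 0, fun _ => false, fun _ => false⟩,
          tapes [] (encCircuit (attackCircuit G s p)) [] [] []⟩ := by
      unfold haltList
      congr 1
      funext k
      cases k
      case out => exact List.map_id _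
      all_goals rfl
    erw [e1]
    refine e.trans (congrArg some ?_)
    exact e2.symm
  · refine h.choose_spec.1.trans (le_of_eq ?_)
    simp
end AttackMachine

/-! ### The attack isolates a row -/

open AttackMachine

/-- Coordinates are hashed from the highest down, so column `i` occupies the coins starting at `s *
(n - 1 - i)`. -/
theorem hashValue_eq_sum {d s : ℕ} (x : Fin d → Bool) (n : ℕ) (r : List Bool) (a : Fin s → Bool)
    (j : Fin s) : hashValue x s n r a j = a j + ∑ i ∈ Finset.range n,
      r.getD (s * (n - 1 - i) + j) false * if h : i < d then x ⟨i, h⟩ else false := by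
  induction n generalizing r a with
  | zero => rw [Finset.range_zero, Finset.sum_empty, add_zero]; rfl
  | succ n ih =>
    rw [hashValue, ih, Finset.sum_range_succ, Nat.add_sub_cancel, Nat.sub_self, Nat.mul_zero,
      zero_add, add_comm (Finset.sum _ _), ← add_assoc]
    congr 1
    refine Finset.sum_congr rfl fun i hi => ?_
    have hi := Finset.mem_range.1 hi
    congr 1
    rw [List.getD_eq_getElem?_getD, List.getElem?_drop, ← List.getD_eq_getElem?_getD]
    congr 1
    obtain ⟨k, rfl⟩ : ∃ k, n = i + 1 + k := ⟨n - (i + 1), by omega⟩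
    rw [show i + 1 + k - 1 - i = k by omega, show i + 1 + k - i = k + 1 by omega]
    ring

theorem hashValue_eq_linearHash {d s : ℕ} (x : Fin d → Bool) (r : List Bool) :
    hashValue x s d r (fun _ => false) =
      linearHash (fun i j => r.getD (s * (Fin.rev i) + j) false) x := by
  funext j
  rw [hashValue_eq_sum, Finset.sum_range]
  refine (zero_add _).trans (Finset.sum_congr rfl fun i _ => ?_)
  rw [dif_pos i.2, show d - 1 - (i : ℕ) = Fin.rev i by rw [Fin.val_rev]; omega]

/-- The final gates look up the hash in a table of random strings. -/
noncomputable def tableGates {K N R : ℕ} (e : (Fin N → Bool) × Fin N ≃ Fin R)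
    (Q : ℕ → Finset (Fin N → Bool)) (k : Fin (K + 2)) (T : Fin R → Bool) : List Gate :=
  finalGates fun u => decide ((fun j => T (e (u, j))) ∈ Q k)

/-- The coins used by the attack, among `L` coins. -/
def coinIndex {N R d L : ℕ} (e : (Fin N → Bool) × Fin N ≃ Fin R) (h : R + d * N ≤ L) :
    ((Fin N → Bool) × Fin N) ⊕ (Fin d × Fin N) → Fin L :=
  fun q => Fin.castLE h (finSumFinEquiv (Sum.map e
    (fun p => finProdFinEquiv (Fin.rev p.1, p.2)) q))

theorem coinIndex_injective {N R d L : ℕ} (e : (Fin N → Bool) × Fin N ≃ Fin R)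
    (h : R + d * N ≤ L) : Function.Injective (coinIndex e h) := by
  refine (Fin.castLE_injective h).comp (finSumFinEquiv.injective.comp
    (Sum.map_injective.2 ⟨e.injective, finProdFinEquiv.injective.comp ?_⟩))
  rintro ⟨a, b⟩ ⟨a', b'⟩ h
  simpa using h

/-- The random table and the random matrix, read off the coins. -/
def coinHom {N R d L : ℕ} (e : (Fin N → Bool) × Fin N ≃ Fin R) (h : R + d * N ≤ L) :
    (Fin L → Bool) →+ ((Fin N → Bool) → Fin N → Bool) × (Fin d → Fin N → Bool) :=
  AddMonoidHom.mk' (fun r => (fun u j => r (coinIndex e h (.inl (u, j))),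
    fun i j => r (coinIndex e h (.inr (i, j))))) fun _ _ => rfl

/-- Distinct entries of the table and the matrix read distinct coins, so all can be prescribed
freely. With `prob_uniform_comp_surjective` this makes the pair uniform. -/
theorem coinHom_surjective {N R d L : ℕ} (e : (Fin N → Bool) × Fin N ≃ Fin R) (h : R + d * N ≤ L) :
    Function.Surjective (coinHom e h) := by
  rintro ⟨T, C⟩
  obtain ⟨r, hr⟩ := (coinIndex_injective e h).surjective_comp_right
    (Sum.elim (fun p => T p.1 p.2) (fun p => C p.1 p.2))
  refine ⟨r, Prod.ext ?_ ?_⟩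
  · funext u j; exact congrFun hr (.inl (u, j))
  · funext i j; exact congrFun hr (.inr (i, j))

theorem getD_ofFn {L : ℕ} (r : Fin L → Bool) (i : Fin L) : (List.ofFn r).getD i false = r i := by
  rw [List.getD_eq_getElem _ _ (by simp)]; simp

theorem eval_attackCircuit {K N R d L : ℕ} (e : (Fin N → Bool) × Fin N ≃ Fin R)
    (Q : ℕ → Finset (Fin N → Bool)) (h : R + d * N ≤ L) (r : Fin L → Bool)
    (l : List (ℕ × Circuit)) (k : ℕ) (φ : Circuit) (hφ : φ ≠ []) (hk : k ≤ K)
    (hl : firstEntry K l = (k, φ)) (x : Fin d → Bool) :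
    (attackCircuit (K := K) (tableGates e Q) N ((d, l), List.ofFn r)).eval x =
      (φ.eval x && decide ((coinHom e h r).1 (linearHash (coinHom e h r).2 x) ∈ Q k)) := by
  have hc : ((cap K k : Fin (K + 2)) : ℕ) = k := by simp [cap]; omega
  have ha : attackCircuit (K := K) (tableGates e Q) N ((d, l), List.ofFn r) =
      hashCircuit φ d ((List.ofFn r).drop R)
        fun u => decide ((fun j => (List.ofFn r).getD (e (u, j)) false) ∈ Q k) := by
    simp only [attackCircuit, hl, hashCircuit, tableGates, hc, zeroGates]
  have h1 (u : Fin N → Bool) (j : Fin N) :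
      (List.ofFn r).getD (e (u, j)) false = (coinHom e h r).1 u j :=
    getD_ofFn r (coinIndex e h (.inl (u, j)))
  have h2 (i : Fin d) (j : Fin N) :
      ((List.ofFn r).drop R).getD (N * (Fin.rev i) + j) false = (coinHom e h r).2 i j := by
    refine Eq.trans ?_ (getD_ofFn r (coinIndex e h (.inr (i, j))))
    rw [List.getD_eq_getElem?_getD, List.getElem?_drop, ← List.getD_eq_getElem?_getD]
    congr 1
    simp [coinIndex, finSumFinEquiv, finProdFinEquiv, add_comm]
  rw [ha, eval_hashCircuit hφ, hashValue_eq_linearHash]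
  simp only [h1, h2]

/-- Since the rows satisfying `φ` are distinct, their set `Y` has as many elements as the published
count, and isolating a point of `Y` is the same as isolating a row. The weight bound holds because
the output implies `φ`. -/
theorem exp_le_prob_attack {K N R d L : ℕ} (e : (Fin N → Bool) × Fin N ≃ Fin R)
    (Q : ℕ → Finset (Fin N → Bool))
    (hQ : ∀ (d : ℕ) (Y : Finset (Fin d → Bool)), 2 ≤ Y.card → Y.card ≤ K →
      Real.exp (-1) ≤ prob (PMF.uniformOfFintype
        (((Fin N → Bool) → Fin N → Bool) × (Fin d → Fin N → Bool)))
        (fun q => ∃! y, y ∈ Y ∧ q.1 (linearHash q.2 y) ∈ Q Y.card))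
    (h : R + d * N ≤ L) (l : List (ℕ × Circuit)) (D : PMF (Fin d → Bool)) {n : ℕ} (x : Dataset n d)
    (φ : Circuit) (h2 : 2 ≤ rowCount x φ) (hK : rowCount x φ ≤ K)
    (hx : Set.InjOn x {i | φ.eval (x i) = true}) (hl : firstEntry K l = (rowCount x φ, φ)) :
    Real.exp (-1) ≤ prob ((PMF.uniformOfFintype (Fin L → Bool)).map fun r =>
        attackCircuit (K := K) (tableGates e Q) N ((d, l), List.ofFn r))
      fun p => Isolates p x ∧ weight D p ≤ weight D φ := by
  classical
  -- The empty circuit is constantly `false`, so no row would satisfy it.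
  have hφ : φ ≠ [] := by
    rintro rfl
    simp [rowCount, Circuit.eval] at h2
  set Y := (Finset.univ.filter fun i => φ.eval (x i) = true).image x with hY
  have hcard : Y.card = rowCount x φ := by
    rw [hY, Finset.card_image_of_injOn (by simpa using hx)]; rfl
  have h1 := hQ d Y (by omega) (by omega)
  rw [← prob_uniform_comp_surjective (coinHom e h) (coinHom_surjective e h)] at h1
  rw [prob_map]
  refine h1.trans (prob_mono _ ?_)
  rintro r - ⟨y, ⟨hy, hT⟩, huni⟩
  have hev := eval_attackCircuit e Q h r l _ φ hφ hK hl
  rw [hcard] at hT huni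
  obtain ⟨i, hi, rfl⟩ := Finset.mem_image.1 hy
  rw [Finset.mem_filter] at hi
  refine ⟨⟨i, ?_, fun i' hi' => ?_⟩, prob_mono _ fun y _ hy => ?_⟩
  · simp [hev, hi.2, hT]
  · simp only [hev, Bool.and_eq_true, decide_eq_true_eq] at hi'
    refine hx hi'.1 hi.2 (huni _ ⟨Finset.mem_image_of_mem _ ?_, hi'.2⟩)
    simp [hi'.1]
  · simp only [hev, Bool.and_eq_true] at hy
    exact hy.1

/-! ### Averaging over releases, and collisions -/

/-- Conditioning on the first stage of an experiment: the bound `c` is only required at outcomes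
satisfying `P`. -/
theorem prob_mul_le_prob_bind {Ω Ω' : Type*} (p : PMF Ω) (f : Ω → PMF Ω') (P : Ω → Prop)
    (P' : Ω' → Prop) {c : ℝ} (hc : 0 ≤ c) (h : ∀ ω ∈ p.support, P ω → c ≤ prob (f ω) P') :
    prob p P * c ≤ prob (p.bind f) P' := by
  have key : p.toOuterMeasure {ω | P ω} * ENNReal.ofReal c ≤
      (p.bind f).toOuterMeasure {ω | P' ω} := by
    rw [PMF.toOuterMeasure_bind_apply, PMF.toOuterMeasure_apply, ← ENNReal.tsum_mul_right]
    refine ENNReal.tsum_le_tsum fun ω => ?_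
    by_cases hω : P ω
    · rw [Set.indicator_of_mem (by exact hω)]
      by_cases h0 : p ω = 0
      · simp [h0]
      · gcongr
        exact ENNReal.ofReal_le_of_le_toReal (h ω ((p.mem_support_iff ω).2 h0) hω)
    · rw [Set.indicator_of_notMem (by exact hω)]; simp
  have := ENNReal.toReal_mono (toOuterMeasure_ne_top _ _) key
  rwa [ENNReal.toReal_mul, ENNReal.toReal_ofReal hc] at this

theorem prob_eq_sum {X : Type*} [Fintype X] (p : PMF X) (P : X → Prop) [DecidablePred P] :
    prob p P = ∑ x, if P x then (p x).toReal else 0 := by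
  rw [prob, PMF.toOuterMeasure_apply_fintype, ENNReal.toReal_sum]
  · refine Finset.sum_congr rfl fun x _ => ?_
    by_cases h : P x <;> simp [Set.indicator, h]
  · intro x _
    exact ne_top_of_le_ne_top (p.apply_ne_top x) (Set.indicator_le_self _ _ _)

/-- The collision probability of two independent samples is at most `∑ D(a)² ≤ M ∑ D(a) = M`. -/
theorem prob_iid_eq_le {X : Type*} [Fintype X] (D : PMF X) {n : ℕ} {i j : Fin n} (hij : i ≠ j)
    {M : ℝ} (hM : ∀ x, (D x).toReal ≤ M) : prob (iid D n) (fun x => x i = x j) ≤ M := by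
  classical
  have hD : ∑ y, (D y).toReal = 1 := by
    rw [← ENNReal.toReal_sum fun y _ => D.apply_ne_top y, ← tsum_fintype (L := .unconditional _),
      D.tsum_coe, ENNReal.toReal_one]
  have h1 (a : X) : prob (iid D n) (fun x => x i = a ∧ x j = a) = (D a).toReal ^ 2 := by
    rw [prob_eq_sum]
    -- Writing the restricted weight as a product over coordinates lets the sum over datasets
    -- factor.
    have e (x : Fin n → X) : (if x i = a ∧ x j = a then (iid D n x).toReal else 0) =
        ∏ l, if (l = i ∨ l = j) → x l = a then (D (x l)).toReal else 0 := by
      split_ifs with h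
      · rw [iid, PMF.ofFintype_apply, ENNReal.toReal_prod]
        refine Finset.prod_congr rfl fun l _ => (if_pos ?_).symm
        rintro (rfl | rfl); exacts [h.1, h.2]
      · symm
        by_cases hi : x i = a
        · exact Finset.prod_eq_zero (Finset.mem_univ j) (if_neg fun h' => h ⟨hi, h' (.inr rfl)⟩)
        · exact Finset.prod_eq_zero (Finset.mem_univ i) (if_neg fun h' => hi (h' (.inl rfl)))
    have e' (l : Fin n) : (∑ y, if (l = i ∨ l = j) → y = a then (D y).toReal else 0) =
        if l ∈ ({i, j} : Finset (Fin n)) then (D a).toReal else 1 := by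
      by_cases hl : l = i ∨ l = j
      · simp [hl]
      · simp [hl, hD]
    rw [Finset.sum_congr rfl fun x _ => e x, ← Fintype.piFinset_univ,
      ← Finset.prod_univ_sum (fun _ => Finset.univ)
        (fun l y => if (l = i ∨ l = j) → y = a then (D y).toReal else 0),
      Finset.prod_congr rfl fun l _ => e' l, Finset.prod_ite_mem]
    simp [Finset.card_pair hij]
  have h2 : prob (iid D n) (fun x => x i = x j) ≤ ∑ a, (D a).toReal ^ 2 := by
    refine (prob_mono _ ?_).trans ((prob_exists_le_sum (iid D n) Finset.univ
      fun a x => x i = a ∧ x j = a).trans (Finset.sum_le_sum fun a _ => (h1 a).le))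
    exact fun x _ hx => ⟨x j, Finset.mem_univ _, hx, rfl⟩
  refine h2.trans ?_
  calc ∑ a, (D a).toReal ^ 2 ≤ ∑ a, M * (D a).toReal := Finset.sum_le_sum fun a _ => by
        rw [sq]; exact mul_le_mul_of_nonneg_right (hM a) ENNReal.toReal_nonneg
    _ = M := by rw [← Finset.mul_sum, hD, mul_one]

theorem prob_not_injective_le {X : Type*} [Fintype X] (D : PMF X) (n : ℕ)
    {M : ℝ} (hM0 : 0 ≤ M) (hM : ∀ x, (D x).toReal ≤ M) :
    prob (iid D n) (fun x => ¬ Function.Injective x) ≤ (n : ℝ) ^ 2 * M := by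
  classical
  have h1 : prob (iid D n) (fun x => ¬ Function.Injective x) ≤
      ∑ q ∈ (Finset.univ : Finset (Fin n)).offDiag, M := by
    refine (prob_mono _ ?_).trans ((prob_exists_le_sum (iid D n) Finset.univ.offDiag
      fun q x => x q.1 = x q.2).trans (Finset.sum_le_sum fun q hq =>
        prob_iid_eq_le D (Finset.mem_offDiag.1 hq).2.2 hM))
    intro x _ hx
    simp only [Function.Injective, not_forall] at hx
    obtain ⟨a, b, hab, hne⟩ := hx
    exact ⟨(a, b), by simp [hne], hab⟩
  rw [Finset.sum_const, nsmul_eq_mul] at h1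
  refine h1.trans (mul_le_mul_of_nonneg_right ?_ hM0)
  rw [Finset.offDiag_card, sq, Finset.card_univ, Fintype.card_fin]
  exact_mod_cast Nat.sub_le _ _

/-- Exponentiated, for `n ≥ 1` the hypothesis reads `max D ≤ 2^(-m) α⁴ / n^kmax`, and `n² ≤ n^kmax`
because `kmax ≥ 2`. For `n = 0` the left side vanishes. -/
theorem sq_mul_iSup_le {X : Type*} [Fintype X] (D : PMF X) {n kmax m : ℕ} {α : ℝ}
    (hkmax : 2 ≤ kmax) (hα : 0 < α)
    (h : (m : ℝ) + 2 * Real.logb 2 (1 / α ^ 2) + (kmax : ℝ) * Real.logb 2 n ≤ minEntropy D) :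
    (n : ℝ) ^ 2 * (⨆ x, (D x).toReal) ≤ (2 : ℝ)⁻¹ ^ m * α ^ 4 := by
  rcases Nat.eq_zero_or_pos n with rfl | hn
  · simp; positivity
  have hn' : (1 : ℝ) ≤ n := by exact_mod_cast hn
  have hb : BddAbove (Set.range fun x => (D x).toReal) := (Set.finite_range _).bddAbove
  set M := ⨆ x, (D x).toReal with hM
  have hM0 : 0 < M := by
    obtain ⟨x, hx⟩ := D.support_nonempty
    exact (ENNReal.toReal_pos ((D.mem_support_iff x).1 hx) (D.apply_ne_top x)).trans_le
      (le_ciSup hb x)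
  have h1 : Real.logb 2 M ≤ Real.logb 2 ((2 : ℝ)⁻¹ ^ m * α ^ 4 / (n : ℝ) ^ kmax) := by
    have e : Real.logb 2 ((2 : ℝ)⁻¹ ^ m * α ^ 4 / (n : ℝ) ^ kmax) =
        -((m : ℝ) + 2 * Real.logb 2 (1 / α ^ 2) + (kmax : ℝ) * Real.logb 2 n) := by
      rw [Real.logb_div (by positivity) (by positivity), Real.logb_mul (by positivity)
        (by positivity), Real.logb_pow, Real.logb_pow, Real.logb_pow, one_div, Real.logb_inv,
        Real.logb_inv, Real.logb_pow, Real.logb_self_eq_one one_lt_two]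
      push_cast
      ring
    rw [e]
    have : minEntropy D = - Real.logb 2 M := rfl
    linarith
  have h2 := (Real.logb_le_logb one_lt_two hM0 (by positivity)).1 h1
  rw [le_div_iff₀ (by positivity)] at h2
  refine le_trans ?_ h2
  rw [mul_comm]
  gcongr

theorem prob_or_le {Ω : Type*} (p : PMF Ω) (P P' : Ω → Prop) :
    prob p (fun ω => P ω ∨ P' ω) ≤ prob p P + prob p P' := by
  have := prob_exists_le_sum p Finset.univ fun (b : Bool) ω => if b then P ω else P' ω
  simpa [or_comm] using this

/-- The two events differ only when the dataset repeats a row, and the dataset marginal of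
`releaseExp` is `D^n`. -/
theorem eta_le {n d : ℕ} (kmax : ℕ) (D : PMF (Fin d → Bool)) (Anon : Anonymizer n d) (w : ℝ) :
    eta kmax D Anon w ≤ etaDistinct kmax D Anon w +
      prob (iid D n) (fun x => ¬ Function.Injective x) := by
  have e : (releaseExp D Anon).map Prod.fst = iid D n := by
    rw [releaseExp, PMF.map_bind]
    simp only [PMF.map_comp]
    exact (congrArg _ (funext fun x => PMF.map_const _ _)).trans (PMF.bind_pure _)
  rw [← e, prob_map]
  refine (prob_mono _ ?_).trans (prob_or_le _ _ _)
  rintro ⟨x, Φ⟩ - ⟨φ, h1, h2⟩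
  by_cases hx : Function.Injective x
  · exact .inl ⟨φ, h1, h2, hx.injOn⟩
  · exact .inr hx

/-! ### The attack and its two guarantees -/

theorem mainTheorem2 (kmax : ℕ) (hkmax : 2 ≤ kmax) :
    ∃ A : Release → PMF Circuit, IsProbPolyTime encRelease encCircuit A ∧
      ∀ (n d k m : ℕ) (α w : ℝ) (D : PMF (Fin d → Bool)) (Anon : Anonymizer n d),
        2 ≤ k → 0 < α → 0 < w →
        (m : ℝ) + 2 * Real.logb 2 (1 / α ^ 2) + (kmax : ℝ) * Real.logb 2 n ≤ minEntropy D →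
        IsPredicateKAnonymous k Anon → IsKMaxBounded kmax Anon →
          etaDistinct kmax D Anon w *
              (Real.exp (-1) - (2 : ℝ)⁻¹ ^ m * n - (k : ℝ) * α ^ 2) ≤ succLow A D Anon w ∧
          eta kmax D Anon w ≤ etaDistinct kmax D Anon w + (2 : ℝ)⁻¹ ^ m * α ^ 4 := by
  obtain ⟨N, Q, hQ⟩ := exists_isolating_tables kmax
  let e : (Fin N → Bool) × Fin N ≃ Fin (Fintype.card ((Fin N → Bool) × Fin N)) :=
    Fintype.equivFin _
  -- Coins for the table, plus `N` per coordinate. The record length is written in unary, so the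
  -- input length is at least `d` and the supply suffices.
  let ℓ : Polynomial ℕ := Polynomial.C (Fintype.card ((Fin N → Bool) × Fin N)) +
    Polynomial.X * Polynomial.C N
  refine ⟨fun a => (PMF.uniformOfFintype (Fin (ℓ.eval (encRelease a).length) → Bool)).map fun r =>
    attackCircuit (K := kmax) (tableGates e Q) N (a, List.ofFn r),
    ⟨ℓ, _, computable_attackCircuit (tableGates e Q) N, fun a => rfl⟩, ?_⟩
  intro n d k m α w D Anon hk hα _ hH hAnon _
  constructor
  -- The error terms are nonnegative, so it is enough to prove success probability `1/e` on each
  -- release counted by `η*`.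
  · have h0 : 0 ≤ (2 : ℝ)⁻¹ ^ m * n + (k : ℝ) * α ^ 2 := by positivity
    refine (mul_le_mul_of_nonneg_left (by linarith : Real.exp (-1) - (2 : ℝ)⁻¹ ^ m * n -
      (k : ℝ) * α ^ 2 ≤ Real.exp (-1)) (prob_nonneg _ _)).trans ?_
    refine prob_mul_le_prob_bind _ _ _ _ (Real.exp_pos _).le ?_
    rintro ⟨x, Φ⟩ hsupp ⟨φ, hφ, hw, hx⟩
    have hΦ : Φ ∈ (Anon x).support := by
      simp only [releaseExp, PMF.mem_support_bind_iff, PMF.mem_support_map_iff] at hsupp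
      obtain ⟨x', -, Φ', hΦ', h⟩ := hsupp
      simp only [Prod.mk.injEq] at h
      rwa [← h.1, ← h.2]
    have hle := List.find?_some hφ
    have hge := hAnon x Φ hΦ φ (List.mem_of_find?_eq_some hφ)
    rw [prob_map]
    -- The published counts are the true ones, so the adversary's search stops exactly at the
    -- target.
    have hl : firstEntry kmax (Φ.map fun φ => (rowCount x φ, φ)) = (rowCount x φ, φ) := by
      rw [firstEntry, List.find?_map]
      have : Φ.find? ((fun e : ℕ × Circuit => decide (e.1 ≤ kmax)) ∘
        fun φ => (rowCount x φ, φ)) = some φ := hφ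
      rw [this]; rfl
    have hlen : Fintype.card ((Fin N → Bool) × Fin N) + d * N ≤
        ℓ.eval (encRelease (d, Φ.map fun φ => (rowCount x φ, φ))).length := by
      simp only [ℓ, Polynomial.eval_add, Polynomial.eval_C, Polynomial.eval_mul, Polynomial.eval_X]
      gcongr
      simp [encRelease, encNat]
    refine (exp_le_prob_attack e Q hQ hlen _ D x φ (hk.trans hge) (by simpa using hle) hx
      hl).trans (prob_mono _ ?_)
    exact fun p _ hp => ⟨hp.1, hp.2.trans hw⟩
  · refine (eta_le kmax D Anon w).trans ?_
    have hb : BddAbove (Set.range fun x => (D x).toReal) := (Set.finite_range _).bddAbove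
    have := prob_not_injective_le D n (Real.iSup_nonneg fun x => ENNReal.toReal_nonneg)
      (fun x => le_ciSup hb x)
    have := sq_mul_iSup_le D hkmax hα hH
    linarith
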